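/- **Setting.** Let $G$ be a finite-dimensional real Lie group with Lie algebra $\mathfrak g=T_eG$, let $M$ be a smooth manifold of dimension $n+1$ with a volume form $\omega$, and let $\pi:E\to M$ be a smooth principal $G$-bundle, $G$ acting on $E$ from the left. Let $\ell$ be a smooth Lagrangian on the first jet bundle $J^1E$. Fix a natural local system: a chart $(x^1,\dots,x^{n+1})$ of $M$, with image $U\subset\mathbb R^{n+1}$, in which $\omega=dx^1\wedge\dots\wedge dx^{n+1}$, and a $G$-equivariant local trivialization $(x,g)$ of $E$ over it, so that the action of $m\in G$ is $g\mapsto mg$. Points of $J^1E$ over $U$ are written $(x,g,\xi_1,\dots,\xi_{n+1})$ with $\xi_\mu\in\mathfrak g$; the jet of a local section $x\mapsto\varphi(x)\in G$ is $j^1\varphi(x)=(x,\varphi(x),\lambda(\partial\varphi/\partial x^\mu))$, where $\lambda_g=T_gL_{g^{-1}}$ is the left Maurer–Cartan form. In this system $\ell=l(x,g,\xi)\,\omega$; $l$ is the reduced Lagrangian. Put $d^nx_\mu=\partial_{x^\mu}\lrcorner\,\omega$, $$\pi^\mu=\frac{\partial l}{\partial\xi_\mu}\in\mathfrak g^*,\qquad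 \Pi^\mu=\mathrm{Ad}^*_{g^{-1}}\pi^\mu,\quad \langle \mathrm{Ad}^*_{g^{-1}}\pi^\mu,\eta\rangle=\langle\pi^\mu,\mathrm{Ad}_{g^{-1}}\eta\rangle ,$$ $$\Theta_\ell=\frac{\partial l}{\partial\xi^A_\mu}\lambda^A\wedge d^nx_\mu-\Big(\frac{\partial l}{\partial\xi^A_\mu}\xi^A_\mu-l\Big)\omega ,$$ where $\pi^\mu_A=\partial l/\partial\xi^A_\mu$ in a basis of $\mathfrak g$. For $\eta\in\mathfrak g$ let $S_\eta$ be the infinitesimal generator of left multiplication and $j^1S_\eta$ its prolongation to $J^1E$, that is $j^1S_\eta=\frac{d}{ds}\big|_{s=0}j^1L_{m(s)}$ for a curve $m$ in $G$ with $m(0)=e$, $m'(0)=\eta$. A smooth local section is critical if, in every natural local system over its domain, the action $\int l(j^1\varphi)\,dx^1\cdots dx^{n+1}$ is stationary under all smooth compactly supported variations of $\varphi$. **Statement.** 1. For every $\eta\in\mathfrak g$, at every point of $J^1E$ over $U$, $$j^1S_\eta\,\lrcorner\,\Theta_\ell=\langle\Pi^\mu,\eta\rangle\,d^nx_\mu=\langle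 J,\eta\rangle,\qquad J:=\Pi^\mu\,d^nx_\mu ,$$ a $\mathfrak g^*$-valued $n$-form on $J^1E$. 2. If the Lagrangian is invariant under left multiplication by $G$, then every $S_\eta$ is an infinitesimal symmetry: $\mathcal L_{j^1S_\eta}\ell=0$ (equivalently $dl(j^1S_\eta)=0$). 3. If $\mathcal L_{j^1S_\eta}\ell=0$ for all $\eta\in\mathfrak g$ (in particular if the Lagrangian is invariant under left multiplication by $G$), then for every critical smooth section $\varphi$, defined on an open set containing the chart domain, the functions $x\mapsto\Pi^\mu(j^1\varphi(x))\in\mathfrak g^*$ are smooth on $U$, the smooth $n$-form $(j^1\varphi)^*J$ is closed, $$0=d\big[(j^1\varphi)^*J\big]=\Big(\sum_\mu\frac{\partial\,\Pi^\mu(j^1\varphi)}{\partial x^\mu}\Big)\,\omega ,$$ and the balance law $\displaystyle\sum_{\mu=1}^{n+1}\frac{\partial\,\Pi^\mu(j^1\varphi)}{\partial x^\mu}=0$ holds on $U$. -/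

import Mathlib

open scoped Manifold ContDiff Topology
open Set MeasureTheory Bundle

namespace ReducedNoether

noncomputable section

/-! ### Coordinates on the base and the forms `ω`, `dⁿx_μ` -/

/-- The space `ℝⁿ⁺¹` of base coordinates `x^μ`. -/
abbrev Coord (n : ℕ) := EuclideanSpace ℝ (Fin (n + 1))

/-- The coordinate vector `∂/∂x^μ`. -/
def partialVec {n : ℕ} (μ : Fin (n + 1)) : Coord n := EuclideanSpace.single μ 1

/-- `ω = dx¹ ∧ ⋯ ∧ dxⁿ⁺¹`. -/
def stdVolume (n : ℕ) : Coord n [⋀^Fin (n + 1)]→L[ℝ] ℝ :=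
  { (EuclideanSpace.basisFun (Fin (n + 1)) ℝ).toBasis.det with
    cont := by
      change Continuous fun v : Fin (n + 1) → Coord n =>
        (EuclideanSpace.basisFun (Fin (n + 1)) ℝ).toBasis.det v
      simp only [Module.Basis.det_apply]
      refine Continuous.matrix_det (continuous_pi fun i => continuous_pi fun j => ?_)
      simp only [Module.Basis.toMatrix_apply, OrthonormalBasis.coe_toBasis_repr_apply,
        EuclideanSpace.basisFun_repr]
      fun_prop }

/-- `dⁿx_μ = ∂/∂x^μ ⌟ ω`. -/
def dnx {n : ℕ} (μ : Fin (n + 1)) : Coord n [⋀^Fin n]→L[ℝ] ℝ :=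
  (stdVolume n).curryLeft (partialVec μ)

/-- The wedge product `α ∧ β` of a 1-form and a `k`-form,
`(α ∧ β)(v₀, …, v_k) = ∑ᵢ (-1)ⁱ α(vᵢ) β(v₀, …, v̂ᵢ, …, v_k)`. -/
def wedgeOne {W : Type*} [NormedAddCommGroup W] [NormedSpace ℝ W] {k : ℕ}
    (α : W →L[ℝ] ℝ) (β : W [⋀^Fin k]→L[ℝ] ℝ) : W [⋀^Fin (k + 1)]→L[ℝ] ℝ :=
  ContinuousAlternatingMap.alternatizeUncurryFin (α.smulRight β)

/-! ### The Lie group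

The Lie group `G` is modelled on the finite-dimensional space `𝔼`.  The Lie algebra is
`𝔤 = T₁G`, which is by definition the space `𝔼`; its dual is `𝔤* = 𝔼 →L[ℝ] ℝ`. -/

section LieGroup

variable {𝔼 : Type*} [NormedAddCommGroup 𝔼] [NormedSpace ℝ 𝔼]
  {G : Type*} [TopologicalSpace G] [ChartedSpace 𝔼 G] [Group G]

/-- The left-invariant vector field with value `ξ ∈ 𝔤` at `1`, at the point `g`:
`ξ ↦ T₁L_g ξ ∈ T_gG`. -/
def leftTranslate (g : G) : 𝔼 →L[ℝ] TangentSpace 𝓘(ℝ, 𝔼) g :=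
  (mfderiv 𝓘(ℝ, 𝔼) 𝓘(ℝ, 𝔼) (fun h : G => g * h) 1 : 𝔼 →L[ℝ] 𝔼)

/-- The left-invariant Maurer-Cartan form `λ_g = T_gL_{g⁻¹} : T_gG → 𝔤`. -/
def maurerCartan (g : G) : TangentSpace 𝓘(ℝ, 𝔼) g →L[ℝ] 𝔼 :=
  (mfderiv 𝓘(ℝ, 𝔼) 𝓘(ℝ, 𝔼) (fun h : G => g⁻¹ * h) g : 𝔼 →L[ℝ] 𝔼)

/-- The adjoint operator `Ad_g : 𝔤 → 𝔤`, the differential at `1` of `h ↦ g h g⁻¹`. -/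
def Ad (g : G) : 𝔼 →L[ℝ] 𝔼 :=
  (mfderiv 𝓘(ℝ, 𝔼) 𝓘(ℝ, 𝔼) (fun h : G => g * h * g⁻¹) 1 : 𝔼 →L[ℝ] 𝔼)

/-- `Ad*_g : 𝔤* → 𝔤*`, `⟨Ad*_g π, η⟩ = ⟨π, Ad_g η⟩`. -/
def coAd (g : G) (p : 𝔼 →L[ℝ] ℝ) : 𝔼 →L[ℝ] ℝ := p ∘L Ad g

end LieGroup

/-! ### The 1-jet bundle in a natural local system -/

/-- Points `(x^μ, g, ξ_μ)` of the 1-jet bundle in a natural local system; the velocity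
coordinates of the jet of `φ` are `ξ_μ = λ(∂φ/∂x^μ) ∈ 𝔤`. -/
abbrev Jet (n : ℕ) (𝔼 G : Type*) := Coord n × G × (Fin (n + 1) → 𝔼)

/-- The tangent spaces `T_{(x,g,ξ)} J¹E = ℝⁿ⁺¹ × T_gG × 𝔤ⁿ⁺¹` (a type synonym for
`TangentSpace`, carrying the norm needed to speak of alternating forms). -/
abbrev JetTangent (n : ℕ) (𝔼 : Type*) := Coord n × 𝔼 × (Fin (n + 1) → 𝔼)

/-- The product smooth structure on the 1-jet bundle. -/
abbrev jetModel (n : ℕ) (𝔼 : Type*) [NormedAddCommGroup 𝔼] [NormedSpace ℝ 𝔼] :=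
  𝓘(ℝ, Coord n).prod (𝓘(ℝ, 𝔼).prod 𝓘(ℝ, Fin (n + 1) → 𝔼))

section Local

variable {n : ℕ} {𝔼 : Type*} [NormedAddCommGroup 𝔼] [NormedSpace ℝ 𝔼]
  {G : Type*} [TopologicalSpace G] [ChartedSpace 𝔼 G] [Group G]

/-- The holonomic lift `j¹φ(x) = (x, φ(x), λ(∂φ/∂x^μ))` of a section given by `φ`. -/
def jetLift (φ : Coord n → G) (x : Coord n) : Jet n 𝔼 G :=
  (x, φ x, fun μ =>
    maurerCartan (𝔼 := 𝔼) (φ x) (mfderiv 𝓘(ℝ, Coord n) 𝓘(ℝ, 𝔼) φ x (partialVec μ)))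

/-- The prolongation to jets of the left multiplication `L_m`: the jet at `g` with tangent
vectors `T₁L_g ξ_μ` goes to the jet at `mg` with tangent vectors `T_gL_m (T₁L_g ξ_μ)`. -/
def leftMulJet (m : G) (p : Jet n 𝔼 G) : Jet n 𝔼 G :=
  (p.1, m * p.2.1, fun μ =>
    maurerCartan (𝔼 := 𝔼) (m * p.2.1)
      (mfderiv 𝓘(ℝ, 𝔼) 𝓘(ℝ, 𝔼) (fun h : G => m * h) p.2.1
        (leftTranslate (𝔼 := 𝔼) p.2.1 (p.2.2 μ))))

/-- The 1-jet prolongation `j¹S_η` of the infinitesimal generator `S_η` of left multiplication: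
`j¹S_η = d/ds|₀ j¹L_{m(s)}` for any curve `m` in `G` with `m(0) = 1`, `m'(0) = η`. -/
def jetGenerator (η : 𝔼) (p : Jet n 𝔼 G) : JetTangent n 𝔼 :=
  (mfderiv 𝓘(ℝ, 𝔼) (jetModel n 𝔼) (fun m : G => leftMulJet m p) 1 : 𝔼 →L[ℝ] JetTangent n 𝔼) η

/-- The left momentum `π^μ = ∂l/∂ξ_μ ∈ 𝔤*`; in a basis of `𝔤`, `π^μ_A = ∂l/∂ξ^A_μ`. -/
def leftMomentum (l : Jet n 𝔼 G → ℝ) (μ : Fin (n + 1)) (p : Jet n 𝔼 G) : 𝔼 →L[ℝ] ℝ :=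
  fderiv ℝ (fun ζ : Fin (n + 1) → 𝔼 => l (p.1, p.2.1, ζ)) p.2.2 ∘L
    ContinuousLinearMap.single ℝ (fun _ : Fin (n + 1) => 𝔼) μ

/-- The right momentum `Π^μ = Ad*_{g⁻¹} π^μ`. -/
def rightMomentum (l : Jet n 𝔼 G → ℝ) (μ : Fin (n + 1)) (p : Jet n 𝔼 G) : 𝔼 →L[ℝ] ℝ :=
  coAd (p.2.1)⁻¹ (leftMomentum l μ p)

/-- Pullback to the jet bundle of a (constant) form on the base. -/
def baseForm (n : ℕ) (𝔼 : Type*) [NormedAddCommGroup 𝔼] [NormedSpace ℝ 𝔼] {k : ℕ}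
    (β : Coord n [⋀^Fin k]→L[ℝ] ℝ) : JetTangent n 𝔼 [⋀^Fin k]→L[ℝ] ℝ :=
  β.compContinuousLinearMap (ContinuousLinearMap.fst ℝ (Coord n) (𝔼 × (Fin (n + 1) → 𝔼)))

/-- The 𝔤-valued Maurer-Cartan form as a 1-form on the jet bundle. -/
def jetMaurerCartan (p : Jet n 𝔼 G) : JetTangent n 𝔼 →L[ℝ] 𝔼 :=
  (maurerCartan (𝔼 := 𝔼) p.2.1 : 𝔼 →L[ℝ] 𝔼) ∘L
    (ContinuousLinearMap.fst ℝ 𝔼 (Fin (n + 1) → 𝔼) ∘L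
      ContinuousLinearMap.snd ℝ (Coord n) (𝔼 × (Fin (n + 1) → 𝔼)))

/-- The Poincaré-Cartan form
`Θ_ℓ = (∂l/∂ξ^A_μ) λ^A ∧ dⁿx_μ - ((∂l/∂ξ^A_μ) ξ^A_μ - l) ω`. -/
def poincareCartan (l : Jet n 𝔼 G → ℝ) (p : Jet n 𝔼 G) :
    JetTangent n 𝔼 [⋀^Fin (n + 1)]→L[ℝ] ℝ :=
  (∑ μ, wedgeOne (leftMomentum l μ p ∘L jetMaurerCartan p) (baseForm n 𝔼 (dnx μ))) -
    ((∑ μ, leftMomentum l μ p (p.2.2 μ)) - l p) • baseForm n 𝔼 (stdVolume n)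

/-- The `𝔤*`-valued `n`-form `J = Π^μ dⁿx_μ` on the jet bundle. -/
def noetherForm (l : Jet n 𝔼 G → ℝ) (p : Jet n 𝔼 G) :
    JetTangent n 𝔼 [⋀^Fin n]→L[ℝ] (𝔼 →L[ℝ] ℝ) :=
  ∑ μ, (ContinuousLinearMap.toSpanSingleton ℝ
    (rightMomentum l μ p)).compContinuousAlternatingMap (baseForm n 𝔼 (dnx μ))

/-- The pullback `(j¹φ)^* J`, a `𝔤*`-valued `n`-form on the base. -/
def pullbackNoether (l : Jet n 𝔼 G → ℝ) (φ : Coord n → G) (x : Coord n) :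
    Coord n [⋀^Fin n]→L[ℝ] (𝔼 →L[ℝ] ℝ) :=
  (noetherForm l (jetLift φ x)).compContinuousLinearMap
    (mfderiv 𝓘(ℝ, Coord n) (jetModel n 𝔼) (jetLift (𝔼 := 𝔼) φ) x :
      Coord n →L[ℝ] JetTangent n 𝔼)

/-- `φ : U → G` is a critical point of the action `∫ l(j¹φ) ω`: for every smooth one-parameter
family `Φ_ε` through `Φ₀ = φ` that is constant in `ε` outside a compact set `K ⊆ U`, the action
on `K` is stationary at `ε = 0`. -/
def IsCriticalOn (l : Jet n 𝔼 G → ℝ) (U : Set (Coord n)) (φ : Coord n → G) : Prop :=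
  ∀ (K : Set (Coord n)) (Φ : ℝ → Coord n → G), IsCompact K → K ⊆ U →
    ContMDiffOn (𝓘(ℝ, ℝ).prod 𝓘(ℝ, Coord n)) 𝓘(ℝ, 𝔼) ∞
      (fun q : ℝ × Coord n => Φ q.1 q.2) (univ ×ˢ U) →
    (∀ x ∈ U, Φ 0 x = φ x) →
    (∀ ε, ∀ x ∈ U, x ∉ K → Φ ε x = φ x) →
    HasDerivAt (fun ε => ∫ x in K, l (jetLift (Φ ε) x)) 0 0

end Local

/-! ### Principal bundles and their natural local systems -/

section Global

variable {n : ℕ} {𝔼 : Type*} [NormedAddCommGroup 𝔼] [NormedSpace ℝ 𝔼]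
  {G : Type*} [TopologicalSpace G] [ChartedSpace 𝔼 G] [Group G]
  {M : Type*} [TopologicalSpace M] [ChartedSpace (Coord n) M]
  {F : Type*} [NormedAddCommGroup F] [NormedSpace ℝ F]
  {P : Type*} [TopologicalSpace P] [ChartedSpace F P] [MulAction G P]

/-- A local trivialization of a principal bundle: smooth, with smooth inverse, and turning the
action of `G` into left multiplication in the group coordinate. -/
structure IsPrincipalTrivialization (n : ℕ) (𝔼 : Type*) [NormedAddCommGroup 𝔼] [NormedSpace ℝ 𝔼]
    (F : Type*) [NormedAddCommGroup F] [NormedSpace ℝ F]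
    {G : Type*} [TopologicalSpace G] [ChartedSpace 𝔼 G] [Group G]
    {M : Type*} [TopologicalSpace M] [ChartedSpace (Coord n) M]
    {P : Type*} [TopologicalSpace P] [ChartedSpace F P] [MulAction G P]
    {pr : P → M} (e : Trivialization G pr) : Prop where
  smooth : ContMDiffOn 𝓘(ℝ, F) (𝓘(ℝ, Coord n).prod 𝓘(ℝ, 𝔼)) ∞ e e.source
  smooth_symm : ContMDiffOn (𝓘(ℝ, Coord n).prod 𝓘(ℝ, 𝔼)) 𝓘(ℝ, F) ∞
    e.toOpenPartialHomeomorph.symm e.target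
  equivariant : ∀ (m : G) (p : P), p ∈ e.source → (e (m • p)).2 = m * (e p).2

/-- `pr : P → M` is a smooth principal `G`-bundle, with `G` acting on `P` from the left. -/
structure IsPrincipalBundle (n : ℕ) (𝔼 : Type*) [NormedAddCommGroup 𝔼] [NormedSpace ℝ 𝔼]
    (F : Type*) [NormedAddCommGroup F] [NormedSpace ℝ F]
    (G : Type*) [TopologicalSpace G] [ChartedSpace 𝔼 G] [Group G]
    {M : Type*} [TopologicalSpace M] [ChartedSpace (Coord n) M]
    {P : Type*} [TopologicalSpace P] [ChartedSpace F P] [MulAction G P]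
    (pr : P → M) : Prop where
  smooth_proj : ContMDiff 𝓘(ℝ, F) 𝓘(ℝ, Coord n) ∞ pr
  smooth_smul : ContMDiff (𝓘(ℝ, 𝔼).prod 𝓘(ℝ, F)) 𝓘(ℝ, F) ∞ (fun q : G × P => q.1 • q.2)
  proj_smul : ∀ (m : G) (p : P), pr (m • p) = pr p
  exists_trivialization : ∀ x : M, ∃ e : Trivialization G pr,
    x ∈ e.baseSet ∧ IsPrincipalTrivialization n 𝔼 F e

/-- The chart `χ` is adapted to `vol`: it is a smooth chart in which `vol = dx¹ ∧ ⋯ ∧ dxⁿ⁺¹`. -/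
structure IsAdaptedChart
    (vol : (x : M) → TangentSpace 𝓘(ℝ, Coord n) x [⋀^Fin (n + 1)]→L[ℝ] ℝ)
    (χ : OpenPartialHomeomorph M (Coord n)) : Prop where
  mem_atlas : χ ∈ IsManifold.maximalAtlas 𝓘(ℝ, Coord n) ∞ M
  volume_eq : ∀ y ∈ χ.source,
    vol y = (stdVolume n).compContinuousLinearMap
      (mfderiv 𝓘(ℝ, Coord n) 𝓘(ℝ, Coord n) χ y : TangentSpace 𝓘(ℝ, Coord n) y →L[ℝ] Coord n)

/-- `vol` is a volume form on `M`: near every point there are coordinates with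
`vol = dx¹ ∧ ⋯ ∧ dxⁿ⁺¹`. -/
def IsVolumeForm (vol : (x : M) → TangentSpace 𝓘(ℝ, Coord n) x [⋀^Fin (n + 1)]→L[ℝ] ℝ) : Prop :=
  ∀ y : M, ∃ χ : OpenPartialHomeomorph M (Coord n), y ∈ χ.source ∧ IsAdaptedChart vol χ

/-- A natural local system `(x^μ, g)` of the principal bundle `pr : P → M`: a chart of `M` adapted
to the volume form, and a local trivialization of `P` over its domain. -/
structure NaturalSystem (𝔼 : Type*) [NormedAddCommGroup 𝔼] [NormedSpace ℝ 𝔼]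
    (F : Type*) [NormedAddCommGroup F] [NormedSpace ℝ F]
    (G : Type*) [TopologicalSpace G] [ChartedSpace 𝔼 G] [Group G]
    {M : Type*} [TopologicalSpace M] [ChartedSpace (Coord n) M]
    {P : Type*} [TopologicalSpace P] [ChartedSpace F P] [MulAction G P] (pr : P → M)
    (vol : (x : M) → TangentSpace 𝓘(ℝ, Coord n) x [⋀^Fin (n + 1)]→L[ℝ] ℝ) where
  chart : OpenPartialHomeomorph M (Coord n)
  adapted : IsAdaptedChart vol chart
  triv : Trivialization G pr
  principal : IsPrincipalTrivialization n 𝔼 F triv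
  source_subset : chart.source ⊆ triv.baseSet

/-- A Lagrangian function on the 1-jet bundle `J¹P`.  A point of `J¹P` over `p ∈ P` is a linear
map `T : T_{pr(p)}M → T_pP` with `T(pr) ∘ T = id`; values at other linear maps are never used. -/
abbrev Lagrangian (n : ℕ) {M : Type*} [TopologicalSpace M] [ChartedSpace (Coord n) M]
    (F : Type*) [NormedAddCommGroup F] [NormedSpace ℝ F]
    {P : Type*} [TopologicalSpace P] [ChartedSpace F P] (pr : P → M) :=
  (p : P) → (TangentSpace 𝓘(ℝ, Coord n) (pr p) →L[ℝ] TangentSpace 𝓘(ℝ, F) p) → ℝ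

/-- The Lagrangian is invariant under left multiplication by `G`, which acts on jets by
`T ↦ T_pL_m ∘ T`. -/
def IsLeftInvariant (G : Type*) [Group G] {pr : P → M} [MulAction G P]
    (L : Lagrangian n F pr) : Prop :=
  ∀ (m : G) (p : P) (T : Coord n →L[ℝ] F),
    (mfderiv 𝓘(ℝ, F) 𝓘(ℝ, Coord n) pr p : F →L[ℝ] Coord n) ∘L T = ContinuousLinearMap.id ℝ _ →
    L (m • p) ((mfderiv 𝓘(ℝ, F) 𝓘(ℝ, F) (fun q : P => m • q) p : F →L[ℝ] F) ∘L T) = L p T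

namespace NaturalSystem

variable {pr : P → M} {vol : (x : M) → TangentSpace 𝓘(ℝ, Coord n) x [⋀^Fin (n + 1)]→L[ℝ] ℝ}

/-- The coordinate domain `U ⊆ ℝⁿ⁺¹`. -/
def domain (S : NaturalSystem 𝔼 F G pr vol) : Set (Coord n) := S.chart.target

/-- The part of the 1-jet bundle lying over the coordinate domain. -/
def jets (S : NaturalSystem 𝔼 F G pr vol) : Set (Jet n 𝔼 G) := {p | p.1 ∈ S.domain}

/-- The local parametrization `(x, g) ↦ p` of `P`. -/
def param (S : NaturalSystem 𝔼 F G pr vol) (q : Coord n × G) : P :=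
  S.triv.toOpenPartialHomeomorph.symm (S.chart.symm q.1, q.2)

/-- The linear map `T_{pr(p)}M → T_pP` which is the jet with coordinates `(x, g, ξ)`: it sends
`∂/∂x^μ` to `∂/∂x^μ + T₁L_g ξ_μ`. -/
def jetMap (S : NaturalSystem 𝔼 F G pr vol) (p : Jet n 𝔼 G) : Coord n →L[ℝ] F :=
  (mfderiv (𝓘(ℝ, Coord n).prod 𝓘(ℝ, 𝔼)) 𝓘(ℝ, F) S.param (p.1, p.2.1) :
      Coord n × 𝔼 →L[ℝ] F) ∘L
    ((ContinuousLinearMap.id ℝ (Coord n)).prod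
      ((leftTranslate (𝔼 := 𝔼) p.2.1 : 𝔼 →L[ℝ] 𝔼) ∘L
        ∑ μ, (EuclideanSpace.proj μ : Coord n →L[ℝ] ℝ).smulRight (p.2.2 μ))) ∘L
    (mfderiv 𝓘(ℝ, Coord n) 𝓘(ℝ, Coord n) S.chart (S.chart.symm p.1) : Coord n →L[ℝ] Coord n)

/-- The reduced Lagrangian `l(x^μ, g, ξ_μ)`: the Lagrangian in the natural local system. -/
def reduced (S : NaturalSystem 𝔼 F G pr vol) (L : Lagrangian n F pr) (p : Jet n 𝔼 G) : ℝ :=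
  L (S.param (p.1, p.2.1)) (S.jetMap p)

/-- The `G`-valued function of the coordinates that represents a section. -/
def rep (S : NaturalSystem 𝔼 F G pr vol) (σ : M → P) (x : Coord n) : G :=
  (S.triv (σ (S.chart.symm x))).2

/-- `S_η` is an infinitesimal natural symmetry of `ℓ = l ω`.  As `j¹S_η` is vertical over the base,
the Lie derivative of `ℓ` is `dl(j¹S_η) ω`. -/
def IsInfinitesimalSymmetry (S : NaturalSystem 𝔼 F G pr vol) (L : Lagrangian n F pr) (η : 𝔼) : Prop :=
  ∀ p ∈ S.jets,
    (mfderiv (jetModel n 𝔼) 𝓘(ℝ, ℝ) (S.reduced L) p : JetTangent n 𝔼 →L[ℝ] ℝ)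
      (jetGenerator η p) = 0

end NaturalSystem

/-- The Lagrangian is smooth on the 1-jet bundle. -/
def IsSmoothLagrangian (𝔼 : Type*) [NormedAddCommGroup 𝔼] [NormedSpace ℝ 𝔼]
    (G : Type*) [TopologicalSpace G] [ChartedSpace 𝔼 G] [Group G] [MulAction G P] {pr : P → M}
    (vol : (x : M) → TangentSpace 𝓘(ℝ, Coord n) x [⋀^Fin (n + 1)]→L[ℝ] ℝ)
    (L : Lagrangian n F pr) : Prop :=
  ∀ S : NaturalSystem 𝔼 F G pr vol, ContMDiffOn (jetModel n 𝔼) 𝓘(ℝ, ℝ) ∞ (S.reduced L) S.jets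

/-- A smooth section of `pr : P → M` over the set `O ⊆ M`. -/
structure IsSmoothSection (n : ℕ) {M : Type*} [TopologicalSpace M] [ChartedSpace (Coord n) M]
    (F : Type*) [NormedAddCommGroup F] [NormedSpace ℝ F]
    {P : Type*} [TopologicalSpace P] [ChartedSpace F P] (pr : P → M) (O : Set M) (σ : M → P) : Prop where
  smooth : ContMDiffOn 𝓘(ℝ, Coord n) 𝓘(ℝ, F) ∞ σ O
  proj : ∀ x ∈ O, pr (σ x) = x

/-- The section `σ` over `O ⊆ M` is critical for the action `∫ (j¹σ)^* ℓ`, `ℓ = l ω`. -/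
def IsCriticalSection (𝔼 : Type*) [NormedAddCommGroup 𝔼] [NormedSpace ℝ 𝔼]
    (G : Type*) [TopologicalSpace G] [ChartedSpace 𝔼 G] [Group G] [MulAction G P] {pr : P → M}
    (vol : (x : M) → TangentSpace 𝓘(ℝ, Coord n) x [⋀^Fin (n + 1)]→L[ℝ] ℝ)
    (L : Lagrangian n F pr) (O : Set M) (σ : M → P) : Prop :=
  ∀ S : NaturalSystem 𝔼 F G pr vol, S.chart.source ⊆ O →
    IsCriticalOn (S.reduced L) S.domain (S.rep σ)

end Global

end

end ReducedNoether

/-! In the left trivialization the jet velocities `ξ_μ` are unchanged by left multiplication, so the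
prolonged action is `(x, g, ξ) ↦ (x, mg, ξ)` (`leftMulJet_eq`) and `j¹S_η = (0, T₁R_g η, 0)`
(`jetGenerator_eq`). This vector is vertical over the base, hence is killed by `ω` and every
`dⁿx_μ`; contracting it with `Θ_ℓ` leaves only `π^μ(λ(T₁R_g η)) dⁿx_μ`, and `λ(T₁R_g η) = Ad_{g⁻¹}
η` turns `π^μ` into `Π^μ`.

Equivariance of the trivialization carries invariance of the Lagrangian over to the reduced
Lagrangian `l` (`reduced_leftMulJet`). Differentiating `l(j¹L_m p) = l(p)` at `m = 1` gives the
infinitesimal symmetry.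

The balance law is Noether's argument with a localized symmetry; the Euler-Lagrange equations are
never derived. Take a curve `m` with `m(0) = 1`, `m'(0) = η`, a test function `f` supported in `U`,
and vary `φ` by `m(εf)φ`. The Leibniz rule for the Maurer-Cartan form (`maurerCartan_mfderiv_mul`)
gives the first variation `f dl(j¹S_η) + ⟨Π^μ, η⟩ ∂_μ f` (`hasDerivAt_leftVariation`). The first
term vanishes by symmetry, so criticality makes `⟨Π^μ, η⟩` orthogonal to all test gradients;
integration by parts and the fundamental lemma of the calculus of variations give zero divergence
(`sum_fderiv_eq_zero_of_integral_eq_zero`). Closedness of the current is the same statement, because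
`d(w^μ dⁿx_μ) = (∂_μ w^μ) ω` (`extDeriv_sum_vectorForm_dnx`). -/

namespace ReducedNoether

/-! ### Differentials in the chart at the identity. -/

section ChartAtOne

variable {𝔼 : Type*} [NormedAddCommGroup 𝔼] [NormedSpace ℝ 𝔼]
  {G : Type*} [TopologicalSpace G] [ChartedSpace 𝔼 G] [Group G]

/-- The manifold derivative is read in the preferred chart at the value. Once maps are translated so
that this value is 1, a single chart serves for all of them, and smoothness questions on `G` become
questions about ordinary derivatives. -/
theorem hasFDerivAt_chartAt_one {E' : Type*} [NormedAddCommGroup E'] [NormedSpace ℝ E']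
    {ψ : E' → G} {x : E'} (hψ : MDifferentiableAt 𝓘(ℝ, E') 𝓘(ℝ, 𝔼) ψ x) (hx : ψ x = 1) :
    HasFDerivAt (fun y => chartAt 𝔼 (1 : G) (ψ y))
      (mfderiv 𝓘(ℝ, E') 𝓘(ℝ, 𝔼) ψ x : E' →L[ℝ] 𝔼) x := by
  have := hψ.hasMFDerivAt.2
  simp only [hx, writtenInExtChartAt, Function.comp_def, mfld_simps] at this
  exact hasFDerivWithinAt_univ.1 this

end ChartAtOne

/-! ### Translations, the Maurer-Cartan form and the generator of left multiplication. -/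

section GroupCalculus

variable {𝔼 : Type*} [NormedAddCommGroup 𝔼] [NormedSpace ℝ 𝔼]
  {G : Type*} [TopologicalSpace G] [ChartedSpace 𝔼 G] [Group G] [LieGroup 𝓘(ℝ, 𝔼) ∞ G]

theorem mdifferentiable_mul_left_group (g : G) :
    MDifferentiable 𝓘(ℝ, 𝔼) 𝓘(ℝ, 𝔼) (fun h : G => g * h) :=
  (contMDiff_mul_left (I := 𝓘(ℝ, 𝔼)) (n := ∞) (a := g)).mdifferentiable (by simp)

theorem mdifferentiable_mul_right_group (g : G) :
    MDifferentiable 𝓘(ℝ, 𝔼) 𝓘(ℝ, 𝔼) (fun h : G => h * g) :=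
  (contMDiff_mul_right (I := 𝓘(ℝ, 𝔼)) (n := ∞) (a := g)).mdifferentiable (by simp)

/-- The Maurer-Cartan form is the differential of left translation to the identity. -/
theorem maurerCartan_comp_mfderiv {E' : Type*} [NormedAddCommGroup E'] [NormedSpace ℝ E']
    {H : Type*} [TopologicalSpace H] [ChartedSpace E' H] {f : H → G} {x : H} {g : G}
    (hf : MDifferentiableAt 𝓘(ℝ, E') 𝓘(ℝ, 𝔼) f x) (hx : f x = g) :
    (maurerCartan (𝔼 := 𝔼) g : 𝔼 →L[ℝ] 𝔼) ∘L (mfderiv 𝓘(ℝ, E') 𝓘(ℝ, 𝔼) f x : E' →L[ℝ] 𝔼) =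
      (mfderiv 𝓘(ℝ, E') 𝓘(ℝ, 𝔼) (fun y => g⁻¹ * f y) x : E' →L[ℝ] 𝔼) := by
  subst hx
  exact (mfderiv_comp x (mdifferentiable_mul_left_group (𝔼 := 𝔼) (f x)⁻¹ (f x)) hf).symm

theorem maurerCartan_leftTranslate (g : G) (ξ : 𝔼) :
    maurerCartan (𝔼 := 𝔼) g (leftTranslate (𝔼 := 𝔼) g ξ) = ξ := by
  have := maurerCartan_comp_mfderiv (𝔼 := 𝔼) (g := g)
    (mdifferentiable_mul_left_group (𝔼 := 𝔼) g 1) (mul_one g)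
  have h2 : (fun y : G => g⁻¹ * (g * y)) = id := by ext; simp
  rw [h2, mfderiv_id] at this
  exact DFunLike.congr_fun this ξ

theorem mfderiv_mul_left_leftTranslate (m g : G) :
    (mfderiv 𝓘(ℝ, 𝔼) 𝓘(ℝ, 𝔼) (fun h : G => m * h) g : 𝔼 →L[ℝ] 𝔼) ∘L
      (leftTranslate (𝔼 := 𝔼) g : 𝔼 →L[ℝ] 𝔼) = (leftTranslate (𝔼 := 𝔼) (m * g) : 𝔼 →L[ℝ] 𝔼) := by
  have := mfderiv_comp_of_eq (x := (1 : G)) (mdifferentiable_mul_left_group (𝔼 := 𝔼) m g)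
    (mdifferentiable_mul_left_group (𝔼 := 𝔼) g 1) (mul_one _)
  have h2 : (fun h : G => m * h) ∘ (fun h => g * h) = fun h => m * g * h := by
    ext; simp [mul_assoc]
  -- The base points `g * 1` and `g` are equal but not definitionally so.
  rw [h2, mfderiv_congr_point (mul_one g)] at this
  exact this.symm

/-- The velocities are left-trivialized: `λ_{mg}` undoes `T_gL_m ∘ T₁L_g = T₁L_{mg}`. -/
theorem leftMulJet_eq {n : ℕ} (m : G) (p : Jet n 𝔼 G) :
    leftMulJet m p = (p.1, m * p.2.1, p.2.2) := by
  refine Prod.ext rfl (Prod.ext rfl (funext fun μ => ?_))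
  have h1 := maurerCartan_leftTranslate (𝔼 := 𝔼) (m * p.2.1) (p.2.2 μ)
  have h2 := DFunLike.congr_fun (mfderiv_mul_left_leftTranslate (𝔼 := 𝔼) m p.2.1) (p.2.2 μ)
  exact (congrArg (maurerCartan (𝔼 := 𝔼) (m * p.2.1)) h2).trans h1

/-- The differential at `1` of right translation `h ↦ h g`. -/
noncomputable def rightTranslate (g : G) : 𝔼 →L[ℝ] 𝔼 :=
  (mfderiv 𝓘(ℝ, 𝔼) 𝓘(ℝ, 𝔼) (fun h : G => h * g) 1 : 𝔼 →L[ℝ] 𝔼)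

/-- Right translation followed by `L_{g⁻¹}` is conjugation by `g⁻¹`; this is where the coadjoint
twist from `π^μ` to `Π^μ` originates. -/
theorem maurerCartan_rightTranslate (g : G) (η : 𝔼) :
    maurerCartan (𝔼 := 𝔼) g (rightTranslate (𝔼 := 𝔼) g η) = Ad (𝔼 := 𝔼) g⁻¹ η := by
  have := maurerCartan_comp_mfderiv (𝔼 := 𝔼) (g := g)
    (mdifferentiable_mul_right_group (𝔼 := 𝔼) g 1) (one_mul g)
  have h2 : (fun y : G => g⁻¹ * (y * g)) = fun y => g⁻¹ * y * g⁻¹⁻¹ := by ext; simp [mul_assoc]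
  rw [h2] at this
  exact DFunLike.congr_fun this η

theorem hasMFDerivAt_leftMulJet {n : ℕ} (p : Jet n 𝔼 G) :
    HasMFDerivAt 𝓘(ℝ, 𝔼) (jetModel n 𝔼) (fun m : G => leftMulJet m p) 1
      ((0 : 𝔼 →L[ℝ] Coord n).prod ((rightTranslate p.2.1).prod
        (0 : 𝔼 →L[ℝ] (Fin (n + 1) → 𝔼)))) := by
  rw [show (fun m : G => leftMulJet m p) = fun m => (p.1, m * p.2.1, p.2.2) from
    funext fun m => leftMulJet_eq (𝔼 := 𝔼) m p]
  exact (hasMFDerivAt_const _ _).prodMk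
    ((mdifferentiable_mul_right_group (𝔼 := 𝔼) p.2.1 1).hasMFDerivAt.prodMk
      (hasMFDerivAt_const _ _))

theorem jetGenerator_eq {n : ℕ} (η : 𝔼) (p : Jet n 𝔼 G) :
    jetGenerator η p = (0, rightTranslate p.2.1 η, 0) := by
  unfold jetGenerator
  rw [(hasMFDerivAt_leftMulJet p).mfderiv]
  rfl

/-- The Maurer-Cartan form pulled back by a map, computed in the chart at `1`. -/
theorem maurerCartan_mfderiv_eq_fderiv {E' : Type*} [NormedAddCommGroup E'] [NormedSpace ℝ E']
    {φ : E' → G} {x : E'} (hφ : MDifferentiableAt 𝓘(ℝ, E') 𝓘(ℝ, 𝔼) φ x) (v : E') :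
    maurerCartan (𝔼 := 𝔼) (φ x) (mfderiv 𝓘(ℝ, E') 𝓘(ℝ, 𝔼) φ x v) =
      fderiv ℝ (fun y => chartAt 𝔼 (1 : G) ((φ x)⁻¹ * φ y)) x v := by
  have h := maurerCartan_comp_mfderiv (𝔼 := 𝔼) (E' := E') (H := E') (g := φ x) hφ rfl
  have hψ : MDifferentiableAt 𝓘(ℝ, E') 𝓘(ℝ, 𝔼) (fun y => (φ x)⁻¹ * φ y) x :=
    (mdifferentiable_mul_left_group (𝔼 := 𝔼) (φ x)⁻¹ (φ x)).comp x hφ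
  have h2 : fderiv ℝ (fun y => chartAt 𝔼 (1 : G) ((φ x)⁻¹ * φ y)) x =
      (mfderiv 𝓘(ℝ, E') 𝓘(ℝ, 𝔼) (fun y => (φ x)⁻¹ * φ y) x : E' →L[ℝ] 𝔼) :=
    HasFDerivAt.fderiv (hasFDerivAt_chartAt_one (𝔼 := 𝔼) hψ (inv_mul_cancel (φ x)))
  exact (DFunLike.congr_fun h v).trans (DFunLike.congr_fun h2 v).symm

end GroupCalculus

/-! ### Wedge products with a 1-form and their contractions. -/

section Forms

theorem removeNth_succ_vecCons {W : Type*} {k : ℕ} (u : W) (v : Fin (k + 1) → W) (i : Fin (k + 1)) :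
    (i.succ).removeNth (Matrix.vecCons u v) = Matrix.vecCons u (i.removeNth v) := by
  funext j
  refine Fin.cases ?_ (fun j => ?_) j
  · simp [Fin.removeNth]
  · simp [Fin.removeNth, Fin.succ_succAbove_succ]

variable {W : Type*} [NormedAddCommGroup W] [NormedSpace ℝ W] {k : ℕ}

theorem wedgeOne_apply (α : W →L[ℝ] ℝ) (β : W [⋀^Fin k]→L[ℝ] ℝ) (v : Fin (k + 1) → W) :
    wedgeOne α β v = ∑ i : Fin (k + 1), (-1) ^ (i : ℕ) * (α (v i) * β (i.removeNth v)) := by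
  simp [wedgeOne, ContinuousAlternatingMap.alternatizeUncurryFin_apply, smul_eq_mul]

theorem wedgeOne_vecCons (α : W →L[ℝ] ℝ) (β : W [⋀^Fin k]→L[ℝ] ℝ) (u : W) (v : Fin k → W) :
    wedgeOne α β (Matrix.vecCons u v) = α u * β v +
      ∑ i : Fin k, (-1) ^ ((i : ℕ) + 1) * (α (v i) * β (i.succ.removeNth (Matrix.vecCons u v))) := by
  rw [wedgeOne_apply, Fin.sum_univ_succ]
  simp [Matrix.vecCons]

/-- Contraction of `α ∧ β` with a vector annihilated by `β`. -/
theorem curryLeft_wedgeOne (α : W →L[ℝ] ℝ) (β : W [⋀^Fin k]→L[ℝ] ℝ) (u : W)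
    (hβ : ∀ (v : Fin k → W) (i : Fin k), v i = u → β v = 0) :
    (wedgeOne α β).curryLeft u = α u • β := by
  ext v
  rw [ContinuousAlternatingMap.curryLeft_apply_apply, wedgeOne_vecCons, Finset.sum_eq_zero]
  · simp
  · intro i _
    -- Having an index `i : Fin k` forces `k` to be positive. Deleting a slot after the first leaves
    -- `u` in slot 0 of the argument of `β`, so the term vanishes.
    obtain ⟨j, rfl⟩ : ∃ j, k = j + 1 := ⟨k - 1, by have := i.isLt; omega⟩
    rw [hβ _ 0 (by simp [removeNth_succ_vecCons]), mul_zero, mul_zero]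

/-- The Laplace-type expansion expressing that a top-degree form has no nonzero wedge with a
1-form. -/
theorem sum_smul_apply_vecCons_removeNth {n : ℕ} (β : Coord n [⋀^Fin (n + 1)]→L[ℝ] ℝ) (e : Coord n)
    (v : Fin (n + 1) → Coord n) :
    ∑ i : Fin (n + 1), ((-1 : ℝ) ^ (i : ℕ) * β (Matrix.vecCons e (i.removeNth v))) • v i
      = β v • e := by
  -- It suffices to test against linear functionals `α`; the coordinate functionals are used at the
  -- end.
  have key : ∀ α : Coord n →L[ℝ] ℝ,
      α (∑ i : Fin (n + 1), ((-1 : ℝ) ^ (i : ℕ) * β (Matrix.vecCons e (i.removeNth v))) • v i)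
        = α (β v • e) := by
    intro α
    -- The form `α ∧ β` has degree `n + 2` on a space of dimension `n + 1`, so it vanishes; its
    -- expansion along the first slot is the claim.
    have h0 : wedgeOne α β (Matrix.vecCons e v) = 0 := by
      refine (wedgeOne α β).toAlternatingMap.map_linearDependent _ fun h => ?_
      simpa using h.fintype_card_le_finrank
    rw [wedgeOne_vecCons] at h0
    simp only [removeNth_succ_vecCons] at h0
    rw [map_sum, map_smul, smul_eq_mul, mul_comm, eq_comm, ← sub_eq_zero, ← h0, sub_eq_add_neg,
      ← Finset.sum_neg_distrib]
    congr 1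
    refine Finset.sum_congr rfl fun i _ => ?_
    rw [map_smul, smul_eq_mul]
    ring
  ext j
  exact key (EuclideanSpace.proj j)

end Forms

/-! ### Exterior derivative of a current. -/

section Current

variable {n : ℕ} {V : Type*} [NormedAddCommGroup V] [NormedSpace ℝ V] [FiniteDimensional ℝ V]

/-- Tensoring a vector with a scalar-valued form. -/
noncomputable def vectorForm {k : ℕ} (β : Coord n [⋀^Fin k]→L[ℝ] ℝ) :
    V →L[ℝ] (Coord n [⋀^Fin k]→L[ℝ] V) :=
  LinearMap.toContinuousLinearMap
    { toFun := fun w => (ContinuousLinearMap.toSpanSingleton ℝ w).compContinuousAlternatingMap β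
      map_add' := fun a b => by ext; simp
      map_smul' := fun a b => by ext v; exact smul_comm (β v) a b }

theorem vectorForm_apply {k : ℕ} (β : Coord n [⋀^Fin k]→L[ℝ] ℝ) (w : V) :
    vectorForm β w = (ContinuousLinearMap.toSpanSingleton ℝ w).compContinuousAlternatingMap β :=
  rfl

/-- The exterior derivative of `∑ w^μ dⁿx_μ` is the divergence of `w` times the volume form. -/
theorem extDeriv_sum_vectorForm_dnx {w : Fin (n + 1) → Coord n → V} {x : Coord n}
    (hw : ∀ μ, DifferentiableAt ℝ (w μ) x) :
    extDeriv (fun y => ∑ μ, vectorForm (dnx μ) (w μ y)) x =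
      vectorForm (stdVolume n) (∑ μ, fderiv ℝ (w μ) x (partialVec μ)) := by
  have hd : HasFDerivAt (fun y => ∑ μ, vectorForm (dnx μ) (w μ y))
      (∑ μ, (vectorForm (dnx μ) : V →L[ℝ] _) ∘L fderiv ℝ (w μ) x) x :=
    HasFDerivAt.fun_sum fun μ _ =>
      (vectorForm (V := V) (dnx μ)).hasFDerivAt.comp x (hw μ).hasFDerivAt
  ext v
  rw [extDeriv, hd.fderiv, ContinuousAlternatingMap.alternatizeUncurryFin_apply, map_sum]
  simp only [_root_.sum_apply, ContinuousAlternatingMap.sum_apply, Finset.smul_sum]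
  rw [Finset.sum_comm]
  refine Finset.sum_congr rfl fun μ _ => ?_
  -- For fixed `μ`, the alternating sum defining `d` is the derivative of `w^μ` applied to the
  -- expansion identity with `e = ∂/∂x^μ`.
  have := congrArg (fderiv ℝ (w μ) x)
    (sum_smul_apply_vecCons_removeNth (stdVolume n) (partialVec μ) v)
  rw [map_smul, map_sum] at this
  simp only [map_smul] at this
  rw [vectorForm_apply]
  simp only [ContinuousLinearMap.compContinuousAlternatingMap_coe, Function.comp_apply,
    ContinuousLinearMap.toSpanSingleton_apply]
  rw [← this]
  refine Finset.sum_congr rfl fun i _ => ?_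
  rcases Nat.even_or_odd (i : ℕ) with h | h <;>
    simp [vectorForm_apply, dnx, ContinuousAlternatingMap.curryLeft_apply_apply, h.neg_one_pow]

end Current

/-! ### The Noether form and contraction of the Poincaré-Cartan form. -/

section NoetherForm

variable {n : ℕ} {𝔼 : Type*} [NormedAddCommGroup 𝔼] [NormedSpace ℝ 𝔼]
  {G : Type*} [TopologicalSpace G] [ChartedSpace 𝔼 G] [Group G]

theorem noetherForm_apply_apply (l : Jet n 𝔼 G → ℝ) (p : Jet n 𝔼 G) (η : 𝔼)
    (v : Fin n → JetTangent n 𝔼) :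
    noetherForm l p v η = (∑ μ, rightMomentum l μ p η • baseForm n 𝔼 (dnx μ)) v := by
  simp [noetherForm, mul_comm]

end NoetherForm

section PoincareCartan

variable {n : ℕ} {𝔼 : Type*} [NormedAddCommGroup 𝔼] [NormedSpace ℝ 𝔼]
  {G : Type*} [TopologicalSpace G] [ChartedSpace 𝔼 G] [Group G] [LieGroup 𝓘(ℝ, 𝔼) ∞ G]

theorem baseForm_eq_zero {k : ℕ} (β : Coord n [⋀^Fin k]→L[ℝ] ℝ) (v : Fin k → JetTangent n 𝔼)
    (i : Fin k) (hi : (v i).1 = 0) : baseForm n 𝔼 β v = 0 :=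
  β.map_coord_zero i hi

theorem leftMomentum_jetMaurerCartan_jetGenerator (l : Jet n 𝔼 G → ℝ) (p : Jet n 𝔼 G) (η : 𝔼)
    (μ : Fin (n + 1)) :
    (leftMomentum l μ p ∘L jetMaurerCartan p) (jetGenerator η p) = rightMomentum l μ p η := by
  rw [jetGenerator_eq]
  exact congrArg (leftMomentum l μ p) (maurerCartan_rightTranslate (𝔼 := 𝔼) p.2.1 η)

/-- Verticality of the generator removes the `ω` term and, in each wedge, every term but the one
where the generator enters the Maurer-Cartan factor. -/
theorem curryLeft_poincareCartan_jetGenerator (l : Jet n 𝔼 G → ℝ) (p : Jet n 𝔼 G) (η : 𝔼) :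
    (poincareCartan l p).curryLeft (jetGenerator η p) =
      ∑ μ, rightMomentum l μ p η • baseForm n 𝔼 (dnx μ) := by
  have h1 : (jetGenerator η p : JetTangent n 𝔼).1 = 0 := by rw [jetGenerator_eq]
  have h2 : (baseForm n 𝔼 (stdVolume n)).curryLeft (jetGenerator η p) = 0 := by
    ext v
    exact baseForm_eq_zero (stdVolume n) _ 0 h1
  have h3 : ∀ μ, (wedgeOne (leftMomentum l μ p ∘L jetMaurerCartan p)
      (baseForm n 𝔼 (dnx μ))).curryLeft (jetGenerator η p) =
      rightMomentum l μ p η • baseForm n 𝔼 (dnx μ) := fun μ => by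
    rw [curryLeft_wedgeOne _ _ _ fun v i hi => baseForm_eq_zero _ v i (by rw [hi, h1]),
      leftMomentum_jetMaurerCartan_jetGenerator]
  simp_rw [← h3]
  ext v
  have h2v := DFunLike.congr_fun h2 v
  rw [ContinuousAlternatingMap.curryLeft_apply_apply] at h2v
  simp [poincareCartan, ContinuousAlternatingMap.curryLeft_apply_apply, h2v]

end PoincareCartan

/-! ### Natural local systems and transfer of invariance. -/

namespace NaturalSystem

variable {n : ℕ} {𝔼 : Type*} [NormedAddCommGroup 𝔼] [NormedSpace ℝ 𝔼]
  {G : Type*} [TopologicalSpace G] [ChartedSpace 𝔼 G] [Group G]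
  {M : Type*} [TopologicalSpace M] [ChartedSpace (Coord n) M]
  {F : Type*} [NormedAddCommGroup F] [NormedSpace ℝ F]
  {P : Type*} [TopologicalSpace P] [ChartedSpace F P] [MulAction G P]
  {pr : P → M} {vol : (x : M) → TangentSpace 𝓘(ℝ, Coord n) x [⋀^Fin (n + 1)]→L[ℝ] ℝ}

theorem isOpen_domain (S : NaturalSystem 𝔼 F G pr vol) : IsOpen S.domain := S.chart.open_target

theorem isOpen_jets (S : NaturalSystem 𝔼 F G pr vol) : IsOpen S.jets :=
  S.isOpen_domain.preimage continuous_fst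

theorem chart_symm_mem_baseSet (S : NaturalSystem 𝔼 F G pr vol) {x : Coord n} (hx : x ∈ S.domain) :
    S.chart.symm x ∈ S.triv.baseSet :=
  S.source_subset (S.chart.map_target hx)

theorem proj_param (S : NaturalSystem 𝔼 F G pr vol) {q : Coord n × G} (hq : q.1 ∈ S.domain) :
    pr (S.param q) = S.chart.symm q.1 :=
  S.triv.proj_symm_apply (S.triv.mem_target.2 (S.chart_symm_mem_baseSet hq))

theorem param_mem_source (S : NaturalSystem 𝔼 F G pr vol) {q : Coord n × G} (hq : q.1 ∈ S.domain) :
    S.param q ∈ S.triv.source :=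
  S.triv.map_target (S.triv.mem_target.2 (S.chart_symm_mem_baseSet hq))

theorem triv_param (S : NaturalSystem 𝔼 F G pr vol) {q : Coord n × G} (hq : q.1 ∈ S.domain) :
    S.triv (S.param q) = (S.chart.symm q.1, q.2) :=
  S.triv.apply_symm_apply (S.triv.mem_target.2 (S.chart_symm_mem_baseSet hq))

/-- Both points lie in the source of the trivialization, which is injective there, so comparing
their trivialized coordinates suffices. -/
theorem smul_param (hpr : IsPrincipalBundle n 𝔼 F G pr) (S : NaturalSystem 𝔼 F G pr vol) (m : G)
    {q : Coord n × G} (hq : q.1 ∈ S.domain) : m • S.param q = S.param (q.1, m * q.2) := by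
  have hs := S.param_mem_source hq
  have hms : m • S.param q ∈ S.triv.source := by
    rw [S.triv.mem_source, hpr.proj_smul, ← S.triv.mem_source]; exact hs
  apply S.triv.injOn hms (S.param_mem_source (q := (q.1, m * q.2)) hq)
  refine Eq.trans (Prod.ext ?_ ?_ : S.triv (m • S.param q) = (S.chart.symm q.1, m * q.2))
    (S.triv_param (q := (q.1, m * q.2)) hq).symm
  · rw [S.triv.coe_fst hms, hpr.proj_smul, S.proj_param hq]
  · rw [S.principal.equivariant m _ hs, S.triv_param hq]

theorem contMDiffAt_param (S : NaturalSystem 𝔼 F G pr vol) {q : Coord n × G}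
    (hq : q.1 ∈ S.domain) :
    ContMDiffAt (𝓘(ℝ, Coord n).prod 𝓘(ℝ, 𝔼)) 𝓘(ℝ, F) ∞ S.param q := by
  have h1 : ContMDiffAt 𝓘(ℝ, Coord n) 𝓘(ℝ, Coord n) ∞ S.chart.symm q.1 :=
    (contMDiffOn_symm_of_mem_maximalAtlas S.adapted.mem_atlas).contMDiffAt
      (S.isOpen_domain.mem_nhds hq)
  have h2 : ContMDiffAt (𝓘(ℝ, Coord n).prod 𝓘(ℝ, 𝔼)) (𝓘(ℝ, Coord n).prod 𝓘(ℝ, 𝔼)) ∞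
      (fun q : Coord n × G => (S.chart.symm q.1, q.2)) q :=
    (h1.comp q contMDiffAt_fst).prodMk contMDiffAt_snd
  have h3 := S.principal.smooth_symm.contMDiffAt (S.triv.open_target.mem_nhds
    (S.triv.mem_target.2 (S.chart_symm_mem_baseSet hq) : (S.chart.symm q.1, q.2) ∈ _))
  exact h3.comp q h2

/-- A jet is a right inverse of the differential of the projection. -/
theorem mfderiv_proj_comp_jetMap (hpr : IsPrincipalBundle n 𝔼 F G pr)
    (S : NaturalSystem 𝔼 F G pr vol) {p : Jet n 𝔼 G} (hp : p ∈ S.jets) :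
    (mfderiv 𝓘(ℝ, F) 𝓘(ℝ, Coord n) pr (S.param (p.1, p.2.1)) : F →L[ℝ] Coord n) ∘L S.jetMap p =
      ContinuousLinearMap.id ℝ _ := by
  have hsymm : MDifferentiableAt 𝓘(ℝ, Coord n) 𝓘(ℝ, Coord n) S.chart.symm p.1 :=
    ((contMDiffOn_symm_of_mem_maximalAtlas S.adapted.mem_atlas).contMDiffAt
      (S.isOpen_domain.mem_nhds hp)).mdifferentiableAt (by simp)
  have hchart : MDifferentiableAt 𝓘(ℝ, Coord n) 𝓘(ℝ, Coord n) S.chart (S.chart.symm p.1) :=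
    ((contMDiffOn_of_mem_maximalAtlas S.adapted.mem_atlas).contMDiffAt
      (S.chart.open_source.mem_nhds (S.chart.map_target hp))).mdifferentiableAt (by simp)
  have h1 := mfderiv_comp (p.1, p.2.1) (hpr.smooth_proj.mdifferentiable (by simp) _)
    ((S.contMDiffAt_param (q := (p.1, p.2.1)) hp).mdifferentiableAt (by simp))
  -- The identity holds only over the coordinate domain, which is enough because derivatives depend
  -- on germs.
  have h2 : pr ∘ S.param =ᶠ[𝓝 (p.1, p.2.1)] fun q => S.chart.symm q.1 := by
    filter_upwards [(S.isOpen_domain.preimage continuous_fst).mem_nhds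
      (show (p.1, p.2.1) ∈ Prod.fst ⁻¹' S.domain from hp)] with q hq
    exact S.proj_param hq
  have h3 := mfderiv_comp (p.1, p.2.1) hsymm (mdifferentiableAt_fst (I := 𝓘(ℝ, Coord n))
    (I' := 𝓘(ℝ, 𝔼)) (x := (p.1, p.2.1)))
  have h4 : (mfderiv 𝓘(ℝ, F) 𝓘(ℝ, Coord n) pr (S.param (p.1, p.2.1)) : F →L[ℝ] Coord n) ∘L
      (mfderiv (𝓘(ℝ, Coord n).prod 𝓘(ℝ, 𝔼)) 𝓘(ℝ, F) S.param (p.1, p.2.1) :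
        Coord n × 𝔼 →L[ℝ] F) =
      (mfderiv 𝓘(ℝ, Coord n) 𝓘(ℝ, Coord n) S.chart.symm p.1 : Coord n →L[ℝ] Coord n) ∘L
        ContinuousLinearMap.fst ℝ (Coord n) 𝔼 := by
    rw [mfderiv_fst] at h3
    exact h1.symm.trans (h2.mfderiv_eq.trans h3)
  have h5 := mfderiv_comp_of_eq (x := S.chart.symm p.1) hsymm hchart (S.chart.right_inv hp)
  have h6 : S.chart.symm ∘ S.chart =ᶠ[𝓝 (S.chart.symm p.1)] id := by
    filter_upwards [S.chart.open_source.mem_nhds (S.chart.map_target hp)] with y hy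
    exact S.chart.left_inv hy
  have h7 : (mfderiv 𝓘(ℝ, Coord n) 𝓘(ℝ, Coord n) S.chart.symm p.1 : Coord n →L[ℝ] Coord n) ∘L
      (mfderiv 𝓘(ℝ, Coord n) 𝓘(ℝ, Coord n) S.chart (S.chart.symm p.1) : Coord n →L[ℝ] Coord n) =
      ContinuousLinearMap.id ℝ (Coord n) := by
    have := h5.symm.trans (h6.mfderiv_eq.trans mfderiv_id)
    rwa [mfderiv_congr_point (S.chart.right_inv hp)] at this
  ext1 v
  exact (DFunLike.congr_fun h4 _).trans (DFunLike.congr_fun h7 v)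

/-- The jet coordinates intertwine left multiplication with the action on jets. -/
theorem jetMap_mul_left [LieGroup 𝓘(ℝ, 𝔼) ∞ G] (hpr : IsPrincipalBundle n 𝔼 F G pr)
    (S : NaturalSystem 𝔼 F G pr vol) (m : G) {p : Jet n 𝔼 G} (hp : p ∈ S.jets) :
    S.jetMap (p.1, m * p.2.1, p.2.2) =
      (mfderiv 𝓘(ℝ, F) 𝓘(ℝ, F) (fun q : P => m • q) (S.param (p.1, p.2.1)) : F →L[ℝ] F) ∘L
        S.jetMap p := by
  have hsm : ContMDiff 𝓘(ℝ, F) 𝓘(ℝ, F) ∞ (fun q : P => m • q) :=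
    hpr.smooth_smul.comp (contMDiff_const.prodMk contMDiff_id)
  have h1 := mfderiv_comp (p.1, p.2.1) (hsm.mdifferentiable (by simp) _)
    ((S.contMDiffAt_param (q := (p.1, p.2.1)) hp).mdifferentiableAt (by simp))
  have h2 : (fun q : P => m • q) ∘ S.param =ᶠ[𝓝 (p.1, p.2.1)]
      S.param ∘ fun q => (q.1, m * q.2) := by
    filter_upwards [(S.isOpen_domain.preimage continuous_fst).mem_nhds
      (show (p.1, p.2.1) ∈ Prod.fst ⁻¹' S.domain from hp)] with q hq
    exact S.smul_param hpr m hq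
  have hL := (mdifferentiable_mul_left_group (𝔼 := 𝔼) m p.2.1).hasMFDerivAt
  have h3 : HasMFDerivAt (𝓘(ℝ, Coord n).prod 𝓘(ℝ, 𝔼)) (𝓘(ℝ, Coord n).prod 𝓘(ℝ, 𝔼))
      (fun q : Coord n × G => (q.1, m * q.2)) (p.1, p.2.1)
      ((ContinuousLinearMap.fst ℝ (Coord n) 𝔼).prod
        ((mfderiv 𝓘(ℝ, 𝔼) 𝓘(ℝ, 𝔼) (fun h : G => m * h) p.2.1 : 𝔼 →L[ℝ] 𝔼) ∘L
          ContinuousLinearMap.snd ℝ (Coord n) 𝔼)) :=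
    (hasMFDerivAt_fst (p.1, p.2.1)).prodMk
      (HasMFDerivAt.comp (p.1, p.2.1) hL (hasMFDerivAt_snd (p.1, p.2.1)))
  have h4 := (HasMFDerivAt.comp (p.1, p.2.1)
    ((S.contMDiffAt_param (q := (p.1, m * p.2.1)) hp).mdifferentiableAt
      (by simp)).hasMFDerivAt h3).mfderiv
  have h5 := h1.symm.trans (h2.mfderiv_eq.trans h4)
  have h6 := mfderiv_mul_left_leftTranslate (𝔼 := 𝔼) m p.2.1
  ext1 v
  refine Eq.trans ?_ (DFunLike.congr_fun h5 _).symm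
  unfold jetMap
  rw [← h6]
  rfl

/-- Invariance is assumed only at right inverses of the differential of `pr`, so
`mfderiv_proj_comp_jetMap` is needed before it can be applied. -/
theorem reduced_leftMulJet [LieGroup 𝓘(ℝ, 𝔼) ∞ G] (hpr : IsPrincipalBundle n 𝔼 F G pr)
    (S : NaturalSystem 𝔼 F G pr vol) {L : Lagrangian n F pr} (hinv : IsLeftInvariant G L)
    (m : G) {p : Jet n 𝔼 G} (hp : p ∈ S.jets) :
    S.reduced L (leftMulJet m p) = S.reduced L p := by
  have h := hinv m _ (S.jetMap p) (S.mfderiv_proj_comp_jetMap hpr hp)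
  rw [leftMulJet_eq]
  refine Eq.trans ?_ h
  -- The type of the second argument of `L` depends on the first. Spelling the tangent spaces as
  -- `Coord n` and `F` allows both equalities to be substituted together.
  have key : ∀ (q q' : P) (T T' : Coord n →L[ℝ] F), q = q' → T = T' → L q T = L q' T' := by
    rintro q _ T _ rfl rfl; rfl
  exact key _ _ _ _ (S.smul_param hpr m (q := (p.1, p.2.1)) hp).symm
    (S.jetMap_mul_left hpr m hp)

theorem isInfinitesimalSymmetry_of_isLeftInvariant [LieGroup 𝓘(ℝ, 𝔼) ∞ G]
    (hpr : IsPrincipalBundle n 𝔼 F G pr) {L : Lagrangian n F pr}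
    (hL : IsSmoothLagrangian 𝔼 G vol L) (S : NaturalSystem 𝔼 F G pr vol)
    (hinv : IsLeftInvariant G L) (η : 𝔼) : S.IsInfinitesimalSymmetry L η := by
  intro p hp
  have h1 : leftMulJet (1 : G) p = p := by rw [leftMulJet_eq]; simp
  have hd : MDifferentiableAt (jetModel n 𝔼) 𝓘(ℝ, ℝ) (S.reduced L) p :=
    ((hL S).contMDiffAt (S.isOpen_jets.mem_nhds hp)).mdifferentiableAt (by simp)
  have h2 := mfderiv_comp_of_eq (x := (1 : G)) hd
    (hasMFDerivAt_leftMulJet p).mdifferentiableAt h1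
  have h3 : S.reduced L ∘ (fun m : G => leftMulJet m p) = fun _ => S.reduced L p :=
    funext fun m => S.reduced_leftMulJet hpr hinv m hp
  rw [h3, mfderiv_const, mfderiv_congr_point h1] at h2
  exact (DFunLike.congr_fun h2 η).symm

end NaturalSystem

/-! ### Smooth dependence of velocities, jets and the adjoint action. -/

section ChartSmooth

variable {𝔼 : Type*} [NormedAddCommGroup 𝔼] [NormedSpace ℝ 𝔼]
  {G : Type*} [TopologicalSpace G] [ChartedSpace 𝔼 G] [Group G] [LieGroup 𝓘(ℝ, 𝔼) ∞ G]
  {E' : Type*} [NormedAddCommGroup E'] [NormedSpace ℝ E']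

theorem contDiffAt_chartAt_one_comp {ψ : E' → G} {x : E'}
    (hψ : ContMDiffAt 𝓘(ℝ, E') 𝓘(ℝ, 𝔼) ∞ ψ x) (hx : ψ x = 1) :
    ContDiffAt ℝ ∞ (fun y => chartAt 𝔼 (1 : G) (ψ y)) x := by
  have : IsManifold 𝓘(ℝ, 𝔼) ∞ G := 
    (inferInstance : ContMDiffMul 𝓘(ℝ, 𝔼) ∞ G).toIsManifold
  have h : ContMDiffAt 𝓘(ℝ, 𝔼) 𝓘(ℝ, 𝔼) ∞ (chartAt 𝔼 (1 : G)) (ψ x) :=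
    contMDiffOn_chart.contMDiffAt ((chartAt 𝔼 (1 : G)).open_source.mem_nhds
      (hx ▸ mem_chart_source 𝔼 (1 : G)))
  exact (h.comp x hψ).contDiffAt

theorem contMDiffAt_inv_mul {f g : E' → G} {x : E'}
    (hf : ContMDiffAt 𝓘(ℝ, E') 𝓘(ℝ, 𝔼) ∞ f x) (hg : ContMDiffAt 𝓘(ℝ, E') 𝓘(ℝ, 𝔼) ∞ g x) :
    ContMDiffAt 𝓘(ℝ, E') 𝓘(ℝ, 𝔼) ∞ (fun y => (f y)⁻¹ * g y) x :=
  hf.inv.mul hg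

/-- The Maurer-Cartan velocities of a smooth family depend smoothly on parameters and point. -/
theorem contDiffAt_maurerCartan_mfderiv {E₁ : Type*} [NormedAddCommGroup E₁] [NormedSpace ℝ E₁]
    {Φ : E₁ → E' → G} {U : Set E'} (hU : IsOpen U)
    (hΦ : ContMDiffOn 𝓘(ℝ, E₁ × E') 𝓘(ℝ, 𝔼) ∞ (fun q : E₁ × E' => Φ q.1 q.2) (univ ×ˢ U))
    (v : E') {q : E₁ × E'} (hq : q.2 ∈ U) :
    ContDiffAt ℝ ∞ (fun q : E₁ × E' =>
      (maurerCartan (𝔼 := 𝔼) (Φ q.1 q.2) (mfderiv 𝓘(ℝ, E') 𝓘(ℝ, 𝔼) (Φ q.1) q.2 v) : 𝔼)) q := by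
  have hat : ∀ q : E₁ × E', q.2 ∈ U →
      ContMDiffAt 𝓘(ℝ, E₁ × E') 𝓘(ℝ, 𝔼) ∞ (fun q : E₁ × E' => Φ q.1 q.2) q := fun q hq =>
    hΦ.contMDiffAt ((isOpen_univ.prod hU).mem_nhds ⟨mem_univ _, hq⟩)
  -- The point `q` is a parameter and `y` the variable to differentiate. At `y = q.2` the translated
  -- map takes the value 1, so the chart at 1 applies, and the parametric derivative of a jointly
  -- smooth map is smooth.
  have h1 : ContDiffAt ℝ ∞ (Function.uncurry fun (q : E₁ × E') (y : E') =>
      chartAt 𝔼 (1 : G) ((Φ q.1 q.2)⁻¹ * Φ q.1 y)) (q, q.2) := by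
    refine contDiffAt_chartAt_one_comp (ψ := fun z : (E₁ × E') × E' =>
      (Φ z.1.1 z.1.2)⁻¹ * Φ z.1.1 z.2) (contMDiffAt_inv_mul ?_ ?_) (by simp)
    · exact (hat q hq).comp (q, q.2) (f := fun z : (E₁ × E') × E' => z.1)
        contDiffAt_fst.contMDiffAt
    · exact (hat q hq).comp (q, q.2) (f := fun z : (E₁ × E') × E' => (z.1.1, z.2))
        (contDiffAt_fst.fst.prodMk contDiffAt_snd).contMDiffAt
  have h2 : ContDiffAt ℝ ∞ (fun q : E₁ × E' => fderiv ℝ (fun y =>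
      chartAt 𝔼 (1 : G) ((Φ q.1 q.2)⁻¹ * Φ q.1 y)) q.2 v) q :=
    (h1.fderiv (m := ∞) contDiffAt_snd (by simp)).clm_apply contDiffAt_const
  refine h2.congr_of_eventuallyEq ?_
  filter_upwards [(hU.preimage continuous_snd).mem_nhds hq] with z hz
  refine maurerCartan_mfderiv_eq_fderiv (𝔼 := 𝔼) ?_ v
  have := (hat z hz).comp z.2 (f := fun y : E' => (z.1, y))
    (contDiffAt_const.prodMk contDiffAt_id).contMDiffAt
  exact this.mdifferentiableAt (by simp)

theorem contMDiffAt_jetLift {n : ℕ} {E₁ : Type*} [NormedAddCommGroup E₁] [NormedSpace ℝ E₁]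
    {Φ : E₁ → Coord n → G} {U : Set (Coord n)} (hU : IsOpen U)
    (hΦ : ContMDiffOn 𝓘(ℝ, E₁ × Coord n) 𝓘(ℝ, 𝔼) ∞ (fun q : E₁ × Coord n => Φ q.1 q.2)
      (univ ×ˢ U)) {q : E₁ × Coord n} (hq : q.2 ∈ U) :
    ContMDiffAt 𝓘(ℝ, E₁ × Coord n) (jetModel n 𝔼) ∞
      (fun q : E₁ × Coord n => jetLift (𝔼 := 𝔼) (Φ q.1) q.2) q := by
  refine contDiffAt_snd.contMDiffAt.prodMk (ContMDiffAt.prodMk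
    (hΦ.contMDiffAt ((isOpen_univ.prod hU).mem_nhds ⟨mem_univ _, hq⟩)) ?_)
  exact (contDiffAt_pi.2 fun μ => contDiffAt_maurerCartan_mfderiv hU hΦ _ hq).contMDiffAt

theorem contMDiffAt_jetLift_section {n : ℕ} {φ : Coord n → G} {U : Set (Coord n)} (hU : IsOpen U)
    (hφ : ContMDiffOn 𝓘(ℝ, Coord n) 𝓘(ℝ, 𝔼) ∞ φ U) {x : Coord n} (hx : x ∈ U) :
    ContMDiffAt 𝓘(ℝ, Coord n) (jetModel n 𝔼) ∞ (jetLift (𝔼 := 𝔼) φ) x := by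
  -- A single section is treated as a family constant in a dummy real parameter.
  have h : ContMDiffOn 𝓘(ℝ, ℝ × Coord n) 𝓘(ℝ, 𝔼) ∞ (fun q : ℝ × Coord n => φ q.2)
      (univ ×ˢ U) :=
    hφ.comp contDiff_snd.contMDiff.contMDiffOn fun q hq => hq.2
  exact (contMDiffAt_jetLift (Φ := fun _ : ℝ => φ) hU h (q := (0, x)) hx).comp x
    (f := fun y : Coord n => ((0 : ℝ), y)) (contDiffAt_const.prodMk contDiffAt_id).contMDiffAt

/-- This expresses `Ad_g` as an ordinary derivative at a point independent of `g`, so that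
smoothness in `g` follows by differentiating with parameters. -/
theorem hasFDerivAt_Ad (g : G) :
    HasFDerivAt (fun u : 𝔼 => chartAt 𝔼 (1 : G) (g * (chartAt 𝔼 (1 : G)).symm u * g⁻¹))
      (Ad (𝔼 := 𝔼) g) (chartAt 𝔼 (1 : G) 1) := by
  have h : MDifferentiableAt 𝓘(ℝ, 𝔼) 𝓘(ℝ, 𝔼) (fun h : G => g * h * g⁻¹) 1 :=
    (mdifferentiable_mul_right_group (𝔼 := 𝔼) g⁻¹ _).comp 1
      (mdifferentiable_mul_left_group (𝔼 := 𝔼) g 1)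
  have h2 := h.hasMFDerivAt.2
  have h1 : g * 1 * g⁻¹ = 1 := by simp
  simp only [h1, writtenInExtChartAt, Function.comp_def, mfld_simps] at h2
  exact hasFDerivWithinAt_univ.1 h2

theorem contDiffAt_Ad_inv {φ : E' → G} {x : E'} (hφ : ContMDiffAt 𝓘(ℝ, E') 𝓘(ℝ, 𝔼) ∞ φ x) :
    ContDiffAt ℝ ∞ (fun y => Ad (𝔼 := 𝔼) (φ y)⁻¹) x := by
  have : IsManifold 𝓘(ℝ, 𝔼) ∞ G := 
    (inferInstance : ContMDiffMul 𝓘(ℝ, 𝔼) ∞ G).toIsManifold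
  have hs : ContMDiffAt 𝓘(ℝ, 𝔼) 𝓘(ℝ, 𝔼) ∞ (chartAt 𝔼 (1 : G)).symm (chartAt 𝔼 (1 : G) 1) :=
    contMDiffOn_chart_symm.contMDiffAt ((chartAt 𝔼 (1 : G)).open_target.mem_nhds
      (mem_chart_target 𝔼 (1 : G)))
  have h1 : ContDiffAt ℝ ∞ (Function.uncurry fun (y : E') (u : 𝔼) =>
      chartAt 𝔼 (1 : G) ((φ y)⁻¹ * (chartAt 𝔼 (1 : G)).symm u * (φ y)⁻¹⁻¹))
      (x, chartAt 𝔼 (1 : G) 1) := by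
    have ha : ContMDiffAt 𝓘(ℝ, E' × 𝔼) 𝓘(ℝ, 𝔼) ∞ (fun z : E' × 𝔼 => (φ z.1)⁻¹)
        (x, chartAt 𝔼 (1 : G) 1) :=
      (hφ.comp (x, chartAt 𝔼 (1 : G) 1) (f := fun z : E' × 𝔼 => z.1)
        contDiffAt_fst.contMDiffAt).inv
    have hb : ContMDiffAt 𝓘(ℝ, E' × 𝔼) 𝓘(ℝ, 𝔼) ∞
        (fun z : E' × 𝔼 => (chartAt 𝔼 (1 : G)).symm z.2) (x, chartAt 𝔼 (1 : G) 1) :=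
      hs.comp (x, chartAt 𝔼 (1 : G) 1) (f := fun z : E' × 𝔼 => z.2) contDiffAt_snd.contMDiffAt
    exact contDiffAt_chartAt_one_comp ((ha.mul hb).mul ha.inv) (by simp)
  have h2 := h1.fderiv (m := ∞) (contDiffAt_const (c := chartAt 𝔼 (1 : G) 1)) (by simp)
  simpa only [(hasFDerivAt_Ad _).fderiv] using h2

end ChartSmooth

/-! ### Smoothness of the right momentum along a section. -/

section Momentum

variable {n : ℕ} {𝔼 : Type*} [NormedAddCommGroup 𝔼] [NormedSpace ℝ 𝔼]
  {G : Type*} [TopologicalSpace G] [ChartedSpace 𝔼 G] [Group G] [LieGroup 𝓘(ℝ, 𝔼) ∞ G]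

theorem contDiffOn_rightMomentum_jetLift {l : Jet n 𝔼 G → ℝ} {φ : Coord n → G}
    {U : Set (Coord n)} (hU : IsOpen U)
    (hl : ContMDiffOn (jetModel n 𝔼) 𝓘(ℝ, ℝ) ∞ l {p | p.1 ∈ U})
    (hφ : ContMDiffOn 𝓘(ℝ, Coord n) 𝓘(ℝ, 𝔼) ∞ φ U) (μ : Fin (n + 1)) :
    ContDiffOn ℝ ∞ (fun x => rightMomentum l μ (jetLift φ x)) U := by
  intro x hx
  refine ContDiffAt.contDiffWithinAt ?_
  have hφx := hφ.contMDiffAt (hU.mem_nhds hx)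
  have hξ : ContDiffAt ℝ ∞ (fun y => (jetLift (𝔼 := 𝔼) φ y).2.2) x :=
    ((contMDiffAt_jetLift_section hU hφ hx).snd.snd).contDiffAt
  have h1 : ContDiffAt ℝ ∞ (Function.uncurry fun (y : Coord n) (ζ : Fin (n + 1) → 𝔼) =>
      l (y, φ y, ζ)) (x, (jetLift (𝔼 := 𝔼) φ x).2.2) := by
    have hlx : ContMDiffAt (jetModel n 𝔼) 𝓘(ℝ, ℝ) ∞ l (x, φ x, (jetLift (𝔼 := 𝔼) φ x).2.2) :=
      hl.contMDiffAt ((hU.preimage continuous_fst).mem_nhds hx)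
    have hc : ContMDiffAt 𝓘(ℝ, Coord n × (Fin (n + 1) → 𝔼)) (jetModel n 𝔼) ∞
        (fun z : Coord n × (Fin (n + 1) → 𝔼) => (z.1, φ z.1, z.2))
        (x, (jetLift (𝔼 := 𝔼) φ x).2.2) :=
      contDiffAt_fst.contMDiffAt.prodMk ((hφx.comp (x, (jetLift (𝔼 := 𝔼) φ x).2.2)
        (f := fun z : Coord n × (Fin (n + 1) → 𝔼) => z.1) contDiffAt_fst.contMDiffAt).prodMk
          contDiffAt_snd.contMDiffAt)
    exact (hlx.comp (x, (jetLift (𝔼 := 𝔼) φ x).2.2) hc).contDiffAt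
  have h2 := h1.fderiv (m := ∞) hξ (by simp)
  exact (h2.clm_comp contDiffAt_const).clm_comp (contDiffAt_Ad_inv hφx)

end Momentum

/-! ### Differentiation under the integral and integrability. -/

section Analysis

variable {E : Type*} [NormedAddCommGroup E] [NormedSpace ℝ E] [MeasurableSpace E] [BorelSpace E]
  {ν : Measure E} [IsFiniteMeasureOnCompacts ν]

/-- Differentiation under the integral over a compact set of a `C¹` family. -/
theorem hasDerivAt_setIntegral_of_contDiffOn {f : ℝ → E → ℝ} {U K : Set E} (hU : IsOpen U)
    (hK : IsCompact K) (hKU : K ⊆ U)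
    (hf : ContDiffOn ℝ 1 (fun q : ℝ × E => f q.1 q.2) (univ ×ˢ U)) (t₀ : ℝ) :
    HasDerivAt (fun t => ∫ x in K, f t x ∂ν) (∫ x in K, deriv (fun t => f t x) t₀ ∂ν) t₀ := by
  have hopen : IsOpen ((univ : Set ℝ) ×ˢ U) := isOpen_univ.prod hU
  set f' : ℝ × E → ℝ := fun q => fderiv ℝ (fun q : ℝ × E => f q.1 q.2) q (1, 0) with hf'
  have hf'c : ContinuousOn f' (univ ×ˢ U) :=
    (hf.continuousOn_fderiv_of_isOpen hopen le_rfl).clm_apply continuousOn_const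
  have hder : ∀ x ∈ U, ∀ t, HasDerivAt (fun t => f t x) (f' (t, x)) t := by
    intro x hx t
    have h1 := ((hf.differentiableOn one_ne_zero).differentiableAt
      (hopen.mem_nhds (show (t, x) ∈ _ from ⟨mem_univ t, hx⟩))).hasFDerivAt
    exact h1.comp_hasDerivAt t ((hasDerivAt_id t).prodMk (hasDerivAt_const t x))
  have hslice : ∀ t, ContinuousOn (f t) K := fun t =>
    hf.continuousOn.comp (by fun_prop : ContinuousOn (fun x => (t, x)) K)
      fun x hx => ⟨mem_univ _, hKU hx⟩
  -- The dominating constant: the time derivative is continuous, hence bounded, on the compact set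
  -- `closedBall t₀ 1 ×ˢ K`.
  obtain ⟨C, hC⟩ := ((isCompact_closedBall t₀ 1).prod hK).exists_bound_of_continuousOn
    (hf'c.mono (prod_mono (subset_univ _) hKU))
  have hcongr : ∫ x in K, deriv (fun t => f t x) t₀ ∂ν = ∫ x in K, f' (t₀, x) ∂ν :=
    setIntegral_congr_fun hK.measurableSet fun x hx => (hder x (hKU hx) t₀).deriv
  rw [hcongr]
  refine (hasDerivAt_integral_of_dominated_loc_of_deriv_le (F' := fun t x => f' (t, x))
    (bound := fun _ => C) (Metric.closedBall_mem_nhds t₀ one_pos)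
    (Filter.Eventually.of_forall fun t => (hslice t).aestronglyMeasurable_of_isCompact hK
      hK.measurableSet) ((hslice t₀).integrableOn_compact hK) ?_ ?_ ?_ ?_).2
  · exact (hf'c.comp (by fun_prop : ContinuousOn (fun x => (t₀, x)) K)
      fun x hx => ⟨mem_univ _, hKU hx⟩).aestronglyMeasurable_of_isCompact hK hK.measurableSet
  · exact (ae_restrict_iff' hK.measurableSet).2 (Filter.Eventually.of_forall fun x hx t ht =>
      hC (t, x) ⟨ht, hx⟩)
  · exact integrableOn_const hK.measure_lt_top.ne
  · exact (ae_restrict_iff' hK.measurableSet).2 (Filter.Eventually.of_forall fun x hx t _ =>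
      hder x (hKU hx) t)

/-- The factor `a` is controlled only on `U`, but the product is supported where `b` is, so it is
continuous everywhere with compact support. -/
theorem integrable_mul_of_tsupport_subset {E : Type*} [TopologicalSpace E] [T2Space E]
    [MeasurableSpace E] [OpensMeasurableSpace E] {ν : Measure E} [IsFiniteMeasureOnCompacts ν] {a b : E → ℝ} {U : Set E} (hU : IsOpen U)
    (ha : ContinuousOn a U) (hb : Continuous b) (hbc : HasCompactSupport b) (hbU : tsupport b ⊆ U) :
    Integrable (fun x => a x * b x) ν := by
  refine Continuous.integrable_of_hasCompactSupport ?_ hbc.mul_left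
  refine (ha.mul hb.continuousOn).continuous_of_tsupport_subset hU ?_
  exact (closure_mono (Function.support_mul_subset_right a b)).trans hbU

end Analysis

/-! ### From weak to pointwise vanishing of the divergence. -/

section WeakDivergence

/-- A smooth vector field orthogonal to all test gradients is divergence free. -/
theorem sum_fderiv_eq_zero_of_integral_eq_zero {n : ℕ} {U : Set (Coord n)} (hU : IsOpen U)
    {w : Fin (n + 1) → Coord n → ℝ} (hw : ∀ μ, ContDiffOn ℝ 1 (w μ) U)
    (h : ∀ f : Coord n → ℝ, ContDiff ℝ ∞ f → HasCompactSupport f → tsupport f ⊆ U →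
      ∫ x, ∑ μ, w μ x * fderiv ℝ f x (partialVec μ) = 0) :
    ∀ x ∈ U, ∑ μ, fderiv ℝ (w μ) x (partialVec μ) = 0 := by
  have hcont : ∀ μ, ContinuousOn (fun x => fderiv ℝ (w μ) x (partialVec μ)) U := fun μ =>
    ((hw μ).continuousOn_fderiv_of_isOpen hU le_rfl).clm_apply continuousOn_const
  have hsum : ContinuousOn (fun x => ∑ μ, fderiv ℝ (w μ) x (partialVec μ)) U :=
    continuousOn_finsetSum _ fun μ _ => hcont μ
  -- The fundamental lemma gives vanishing almost everywhere on `U`; continuity of the divergence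
  -- then gives it at every point.
  have hae := hU.ae_eq_zero_of_integral_contDiff_smul_eq_zero (μ := volume)
    (hsum.locallyIntegrableOn hU.measurableSet) (fun f hf hfc hfU => ?_)
  · have h1 : (fun x => ∑ μ, fderiv ℝ (w μ) x (partialVec μ)) =ᵐ[volume.restrict U]
        fun _ => (0 : ℝ) := (ae_restrict_iff' hU.measurableSet).2 hae
    exact fun x hx => Measure.eqOn_open_of_ae_eq h1 hU hsum continuousOn_const hx
  · have hf' : ∀ μ, Continuous fun x => fderiv ℝ f x (partialVec μ) := fun μ =>
      (hf.continuous_fderiv (by simp)).clm_apply continuous_const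
    have hf's : ∀ μ : Fin (n + 1), tsupport (fun x => fderiv ℝ f x (partialVec μ)) ⊆ tsupport f :=
      fun μ => tsupport_fderiv_apply_subset ℝ (partialVec μ)
    have hi1 : ∀ μ, Integrable fun x => w μ x * fderiv ℝ f x (partialVec μ) := fun μ =>
      integrable_mul_of_tsupport_subset hU (hw μ).continuousOn (hf' μ)
        (hfc.fderiv_apply ℝ (partialVec μ)) ((hf's μ).trans hfU)
    have hi2 : ∀ μ, Integrable fun x => fderiv ℝ (w μ) x (partialVec μ) * f x := fun μ =>
      integrable_mul_of_tsupport_subset hU (hcont μ) hf.continuous hfc hfU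
    -- Compact support of `f` leaves no boundary term, and `w μ` need be differentiable only on the
    -- support of `f`.
    have hparts : ∀ μ, ∫ x, w μ x * fderiv ℝ f x (partialVec μ) =
        - ∫ x, fderiv ℝ (w μ) x (partialVec μ) * f x := fun μ =>
      integral_mul_fderiv_eq_neg_fderiv_mul_of_integrable (hi2 μ) (hi1 μ)
        (integrable_mul_of_tsupport_subset hU (hw μ).continuousOn hf.continuous hfc hfU)
        (fun x hx => ((hw μ).differentiableOn one_ne_zero).differentiableAt (hU.mem_nhds (hfU hx)))
        (fun x _ => hf.differentiable (by simp) x)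
    have h0 := h f hf hfc hfU
    rw [integral_finsetSum _ fun μ _ => hi1 μ, Finset.sum_congr rfl fun μ _ => hparts μ,
      Finset.sum_neg_distrib, neg_eq_zero, ← integral_finsetSum _ fun μ _ => hi2 μ] at h0
    rw [← h0]
    congr 1 with x
    rw [smul_eq_mul, Finset.mul_sum]
    exact Finset.sum_congr rfl fun μ _ => mul_comm _ _

end WeakDivergence

/-! ### Curves through the identity. -/

section MaurerCartanOne

variable {𝔼 : Type*} [NormedAddCommGroup 𝔼] [NormedSpace ℝ 𝔼]
  {G : Type*} [TopologicalSpace G] [ChartedSpace 𝔼 G] [Group G]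

theorem maurerCartan_one_apply (η : 𝔼) :
    (maurerCartan (𝔼 := 𝔼) (1 : G) : 𝔼 →L[ℝ] 𝔼) η = η := by
  have h : (fun h : G => (1 : G)⁻¹ * h) = id := by ext; simp
  unfold maurerCartan
  rw [h, mfderiv_id]
  rfl

end MaurerCartanOne

section Curve

variable {𝔼 : Type*} [NormedAddCommGroup 𝔼] [NormedSpace ℝ 𝔼]
  {G : Type*} [TopologicalSpace G] [ChartedSpace 𝔼 G] [Group G] [LieGroup 𝓘(ℝ, 𝔼) ∞ G]

/-- Every element of the Lie algebra is the velocity at the identity of a smooth curve defined on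
the whole line. -/
theorem exists_curve_one (η : 𝔼) :
    ∃ m : ℝ → G, ContMDiff 𝓘(ℝ, ℝ) 𝓘(ℝ, 𝔼) ∞ m ∧ m 0 = 1 ∧
      (mfderiv 𝓘(ℝ, ℝ) 𝓘(ℝ, 𝔼) m 0 : ℝ →L[ℝ] 𝔼) 1 = η := by
  have : IsManifold 𝓘(ℝ, 𝔼) ∞ G :=
    (inferInstance : ContMDiffMul 𝓘(ℝ, 𝔼) ∞ G).toIsManifold
  set κ := chartAt 𝔼 (1 : G) with hκ
  obtain ⟨r, hr, hball⟩ := Metric.isOpen_iff.1 κ.open_target (κ 1) (mem_chart_target 𝔼 (1 : G))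
  -- The function `δ sin(t/δ)` has slope 1 at 0 and amplitude `δ`. Since `δ‖η‖ ≤ r/2`, the curve
  -- stays in the chart for all times; the `+ 1` covers `η = 0`.
  set δ : ℝ := r / (2 * (‖η‖ + 1)) with hδ
  have hδ0 : 0 < δ := by positivity
  set c : ℝ → 𝔼 := fun t => κ 1 + (δ * Real.sin (t / δ)) • η with hc
  have hcs : ContDiff ℝ ∞ c := by
    refine contDiff_const.add (ContDiff.smul (contDiff_const.mul ?_) contDiff_const)
    exact Real.contDiff_sin.comp (contDiff_id.div_const δ)
  have hct : ∀ t, c t ∈ κ.target := by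
    intro t
    apply hball
    rw [Metric.mem_ball, dist_eq_norm, hc, add_sub_cancel_left, norm_smul, norm_mul,
      Real.norm_of_nonneg hδ0.le, Real.norm_eq_abs]
    calc δ * |Real.sin (t / δ)| * ‖η‖ ≤ δ * 1 * (‖η‖ + 1) := by
          gcongr
          · exact Real.abs_sin_le_one _
          · linarith
      _ = r / 2 := by rw [hδ]; field_simp
      _ < r := half_lt_self hr
  have hm : ContMDiff 𝓘(ℝ, ℝ) 𝓘(ℝ, 𝔼) ∞ (fun t => κ.symm (c t)) := fun t =>
    (contMDiffOn_chart_symm.contMDiffAt (κ.open_target.mem_nhds (hct t))).comp t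
      hcs.contMDiff.contMDiffAt
  have h0 : κ.symm (c 0) = 1 := by
    simp [hc, hκ]
  refine ⟨fun t => κ.symm (c t), hm, h0, ?_⟩
  have h1 := hasFDerivAt_chartAt_one (𝔼 := 𝔼) ((hm 0).mdifferentiableAt (by simp)) h0
  have h2 : (fun t => chartAt 𝔼 (1 : G) (κ.symm (c t))) = c := funext fun t => κ.right_inv (hct t)
  rw [h2] at h1
  have h3 : HasDerivAt c η 0 := by
    have hs : HasDerivAt (fun t : ℝ => δ * Real.sin (t / δ)) 1 0 := by
      have := ((Real.hasDerivAt_sin (0 / δ)).comp 0 ((hasDerivAt_id (0 : ℝ)).div_const δ)).const_mul δ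
      simpa [hδ0.ne'] using this
    simpa only [one_smul] using (hs.smul_const η).const_add (κ 1)
  have h4 : (mfderiv 𝓘(ℝ, ℝ) 𝓘(ℝ, 𝔼) (fun t => κ.symm (c t)) 0 : ℝ →L[ℝ] 𝔼) =
    ContinuousLinearMap.toSpanSingleton ℝ η := 
    (h3.hasFDerivAt.unique h1).symm
  exact (DFunLike.congr_fun h4 1).trans (one_smul ℝ η)

end Curve

/-! ### The Leibniz rule for the Maurer-Cartan form. -/

section ProductRule

variable {𝔼 : Type*} [NormedAddCommGroup 𝔼] [NormedSpace ℝ 𝔼]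
  {G : Type*} [TopologicalSpace G] [ChartedSpace 𝔼 G] [Group G] [LieGroup 𝓘(ℝ, 𝔼) ∞ G]
  {E' : Type*} [NormedAddCommGroup E'] [NormedSpace ℝ E']

theorem mfderiv_conj_comp {ψ : E' → G} {x : E'} (g : G)
    (hψ : MDifferentiableAt 𝓘(ℝ, E') 𝓘(ℝ, 𝔼) ψ x) (hx : ψ x = 1) :
    (mfderiv 𝓘(ℝ, E') 𝓘(ℝ, 𝔼) (fun y => g * ψ y * g⁻¹) x : E' →L[ℝ] 𝔼) =
      (Ad (𝔼 := 𝔼) g) ∘L (mfderiv 𝓘(ℝ, E') 𝓘(ℝ, 𝔼) ψ x : E' →L[ℝ] 𝔼) := by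
  have h : MDifferentiableAt 𝓘(ℝ, 𝔼) 𝓘(ℝ, 𝔼) (fun h : G => g * h * g⁻¹) 1 :=
    (mdifferentiable_mul_right_group (𝔼 := 𝔼) g⁻¹ _).comp 1
      (mdifferentiable_mul_left_group (𝔼 := 𝔼) g 1)
  have h2 := mfderiv_comp_of_eq h hψ hx
  rw [mfderiv_congr_point hx] at h2
  exact h2

/-- Leibniz rule for the Maurer-Cartan form of a product of two maps. -/
theorem maurerCartan_mfderiv_mul {γ φ : E' → G} {x : E'}
    (hγ : MDifferentiableAt 𝓘(ℝ, E') 𝓘(ℝ, 𝔼) γ x) (hφ : MDifferentiableAt 𝓘(ℝ, E') 𝓘(ℝ, 𝔼) φ x)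
    (v : E') :
    (maurerCartan (𝔼 := 𝔼) (γ x * φ x) : 𝔼 →L[ℝ] 𝔼)
        ((mfderiv 𝓘(ℝ, E') 𝓘(ℝ, 𝔼) (fun y => γ y * φ y) x : E' →L[ℝ] 𝔼) v) =
      Ad (𝔼 := 𝔼) (φ x)⁻¹ ((maurerCartan (𝔼 := 𝔼) (γ x) : 𝔼 →L[ℝ] 𝔼)
        ((mfderiv 𝓘(ℝ, E') 𝓘(ℝ, 𝔼) γ x : E' →L[ℝ] 𝔼) v)) +
      (maurerCartan (𝔼 := 𝔼) (φ x) : 𝔼 →L[ℝ] 𝔼)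
        ((mfderiv 𝓘(ℝ, E') 𝓘(ℝ, 𝔼) φ x : E' →L[ℝ] 𝔼) v) := by
  have hγR : MDifferentiableAt 𝓘(ℝ, E') 𝓘(ℝ, 𝔼) (fun y => γ y * φ x) x :=
    (mdifferentiable_mul_right_group (𝔼 := 𝔼) (φ x) _).comp x hγ
  have hφL : MDifferentiableAt 𝓘(ℝ, E') 𝓘(ℝ, 𝔼) (fun y => γ x * φ y) x :=
    (mdifferentiable_mul_left_group (𝔼 := 𝔼) (γ x) _).comp x hφ
  have hmul : MDifferentiable (𝓘(ℝ, 𝔼).prod 𝓘(ℝ, 𝔼)) 𝓘(ℝ, 𝔼) (fun p : G × G => p.1 * p.2) :=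
    (contMDiff_mul 𝓘(ℝ, 𝔼) ∞).mdifferentiable (by simp)
  have hsum : (mfderiv 𝓘(ℝ, E') 𝓘(ℝ, 𝔼) (fun y => γ y * φ y) x : E' →L[ℝ] 𝔼) v =
      (mfderiv 𝓘(ℝ, E') 𝓘(ℝ, 𝔼) (fun y => γ y * φ x) x : E' →L[ℝ] 𝔼) v +
      (mfderiv 𝓘(ℝ, E') 𝓘(ℝ, 𝔼) (fun y => γ x * φ y) x : E' →L[ℝ] 𝔼) v := by
    have h1 := mfderiv_comp_apply x (f := fun y => (γ y, φ y)) (hmul (γ x, φ x)) (hγ.prodMk hφ) v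
    rw [mfderiv_prodMk hγ hφ] at h1
    have h2 := (fun w => mfderiv_prod_eq_add_apply (v := w) (hmul (γ x, φ x)))
      ((mfderiv 𝓘(ℝ, E') 𝓘(ℝ, 𝔼) γ x v, mfderiv 𝓘(ℝ, E') 𝓘(ℝ, 𝔼) φ x v) : 𝔼 × 𝔼)
    have h3 := mfderiv_comp_apply x (f := γ) (g := fun h => h * φ x)
      (mdifferentiable_mul_right_group (𝔼 := 𝔼) (φ x) _) hγ v
    have h4 := mfderiv_comp_apply x (f := φ) (g := fun h => γ x * h)
      (mdifferentiable_mul_left_group (𝔼 := 𝔼) (γ x) _) hφ v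
    exact h1.trans (h2.trans (congrArg₂ (fun a b : 𝔼 => a + b) h3.symm h4.symm))
  have hA := DFunLike.congr_fun
    (maurerCartan_comp_mfderiv (𝔼 := 𝔼) (g := γ x * φ x) hγR rfl) v
  have hB := DFunLike.congr_fun
    (maurerCartan_comp_mfderiv (𝔼 := 𝔼) (g := γ x * φ x) hφL rfl) v
  have hC := DFunLike.congr_fun (maurerCartan_comp_mfderiv (𝔼 := 𝔼) (g := γ x) hγ rfl) v
  have hD := DFunLike.congr_fun (maurerCartan_comp_mfderiv (𝔼 := 𝔼) (g := φ x) hφ rfl) v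
  -- With `φ` frozen, the translated product is a conjugate by `(φ x)⁻¹`, the source of `Ad`; with
  -- `γ` frozen, `γ x` cancels.
  have e1 : (fun y => (γ x * φ x)⁻¹ * (γ y * φ x)) =
      fun y => (φ x)⁻¹ * ((γ x)⁻¹ * γ y) * (φ x)⁻¹⁻¹ := by ext; simp [mul_assoc]
  have e2 : (fun y => (γ x * φ x)⁻¹ * (γ x * φ y)) = fun y => (φ x)⁻¹ * φ y := by
    ext; simp [mul_assoc]
  have hψ : MDifferentiableAt 𝓘(ℝ, E') 𝓘(ℝ, 𝔼) (fun y => (γ x)⁻¹ * γ y) x :=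
    (mdifferentiable_mul_left_group (𝔼 := 𝔼) (γ x)⁻¹ _).comp x hγ
  have hE := DFunLike.congr_fun (mfderiv_conj_comp (φ x)⁻¹ hψ (inv_mul_cancel _)) v
  rw [e1] at hA
  rw [e2] at hB
  refine (congrArg (maurerCartan (𝔼 := 𝔼) (γ x * φ x) : 𝔼 →L[ℝ] 𝔼) hsum).trans ?_
  rw [map_add]
  exact congrArg₂ (fun a b : 𝔼 => a + b) ((hA.trans hE).trans (congrArg (Ad (𝔼 := 𝔼) (φ x)⁻¹) hC.symm))
    (hB.trans hD.symm)

end ProductRule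

/-! ### First variation under localized left translations. -/

section JetDifferential

variable {n : ℕ} {𝔼 : Type*} [NormedAddCommGroup 𝔼] [NormedSpace ℝ 𝔼]
  {G : Type*} [TopologicalSpace G] [ChartedSpace 𝔼 G]

/-- The differential of a function on the jet bundle. -/
noncomputable def jetDifferential (l : Jet n 𝔼 G → ℝ) (p : Jet n 𝔼 G) : JetTangent n 𝔼 →L[ℝ] ℝ :=
  (mfderiv (jetModel n 𝔼) 𝓘(ℝ, ℝ) l p : JetTangent n 𝔼 →L[ℝ] ℝ)

theorem hasMFDerivAt_jetDifferential {l : Jet n 𝔼 G → ℝ} {p : Jet n 𝔼 G}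
    (hl : MDifferentiableAt (jetModel n 𝔼) 𝓘(ℝ, ℝ) l p) :
    HasMFDerivAt (jetModel n 𝔼) 𝓘(ℝ, ℝ) l p (jetDifferential l p) :=
  hl.hasMFDerivAt

theorem jetDifferential_vertical [Group G] {l : Jet n 𝔼 G → ℝ} {p : Jet n 𝔼 G}
    (hl : MDifferentiableAt (jetModel n 𝔼) 𝓘(ℝ, ℝ) l p) (w : Fin (n + 1) → 𝔼) :
    jetDifferential l p (0, 0, w) = ∑ μ, leftMomentum l μ p (w μ) := by
  have h1 : HasMFDerivAt 𝓘(ℝ, Fin (n + 1) → 𝔼) (jetModel n 𝔼)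
      (fun ζ : Fin (n + 1) → 𝔼 => ((p.1, p.2.1, ζ) : Jet n 𝔼 G)) p.2.2
      ((0 : (Fin (n + 1) → 𝔼) →L[ℝ] Coord n).prod
        ((0 : (Fin (n + 1) → 𝔼) →L[ℝ] 𝔼).prod (ContinuousLinearMap.id ℝ (Fin (n + 1) → 𝔼)))) :=
    (hasMFDerivAt_const _ _).prodMk ((hasMFDerivAt_const _ _).prodMk (hasMFDerivAt_id _))
  have h2 : HasFDerivAt (fun ζ : Fin (n + 1) → 𝔼 => l (p.1, p.2.1, ζ))
      (jetDifferential l p ∘L (0 : (Fin (n + 1) → 𝔼) →L[ℝ] Coord n).prod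
        ((0 : (Fin (n + 1) → 𝔼) →L[ℝ] 𝔼).prod (ContinuousLinearMap.id ℝ (Fin (n + 1) → 𝔼))))
      p.2.2 :=
    (HasMFDerivAt.comp (x := p.2.2) (hasMFDerivAt_jetDifferential hl) h1).hasFDerivAt
  have h3 : fderiv ℝ (fun ζ : Fin (n + 1) → 𝔼 => l (p.1, p.2.1, ζ)) p.2.2 w =
      jetDifferential l p (0, 0, w) := by rw [h2.fderiv]; rfl
  rw [← h3]
  conv_lhs => rw [← Finset.univ_sum_single w]
  rw [map_sum]
  rfl

end JetDifferential

section LeftVariation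

variable {n : ℕ} {G : Type*} [Group G]

/-- The variation of `φ` by left translation along the curve `m`, localized by `f`. -/
def leftVariation (m : ℝ → G) (f : Coord n → ℝ) (φ : Coord n → G) (ε : ℝ) (x : Coord n) : G :=
  m (ε * f x) * φ x

theorem leftVariation_zero {m : ℝ → G} (hm0 : m 0 = 1) (f : Coord n → ℝ) (φ : Coord n → G) :
    leftVariation m f φ 0 = φ := by
  funext x
  simp [leftVariation, hm0]

end LeftVariation

section Variation

variable {n : ℕ} {𝔼 : Type*} [NormedAddCommGroup 𝔼] [NormedSpace ℝ 𝔼]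
  {G : Type*} [TopologicalSpace G] [ChartedSpace 𝔼 G] [Group G] [LieGroup 𝓘(ℝ, 𝔼) ∞ G]

theorem contMDiffOn_leftVariation {m : ℝ → G} (hm : ContMDiff 𝓘(ℝ, ℝ) 𝓘(ℝ, 𝔼) ∞ m)
    {f : Coord n → ℝ} (hf : ContDiff ℝ ∞ f) {φ : Coord n → G} {U : Set (Coord n)}
    (hφ : ContMDiffOn 𝓘(ℝ, Coord n) 𝓘(ℝ, 𝔼) ∞ φ U) :
    ContMDiffOn 𝓘(ℝ, ℝ × Coord n) 𝓘(ℝ, 𝔼) ∞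
      (fun q : ℝ × Coord n => leftVariation m f φ q.1 q.2) (univ ×ˢ U) := by
  have h1 : ContMDiff 𝓘(ℝ, ℝ × Coord n) 𝓘(ℝ, 𝔼) ∞ (fun q : ℝ × Coord n => m (q.1 * f q.2)) :=
    hm.comp (contDiff_fst.mul (hf.comp contDiff_snd)).contMDiff
  have h2 : ContMDiffOn 𝓘(ℝ, ℝ × Coord n) 𝓘(ℝ, 𝔼) ∞ (fun q : ℝ × Coord n => φ q.2)
      (univ ×ˢ U) :=
    hφ.comp contDiff_snd.contMDiff.contMDiffOn fun q hq => hq.2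
  exact h1.contMDiffOn.mul h2

/-- The left-trivialized velocity of a curve in the group. -/
noncomputable def curveVelocity (m : ℝ → G) (t : ℝ) : 𝔼 :=
  (maurerCartan (𝔼 := 𝔼) (m t) : 𝔼 →L[ℝ] 𝔼) ((mfderiv 𝓘(ℝ, ℝ) 𝓘(ℝ, 𝔼) m t : ℝ →L[ℝ] 𝔼) 1)

theorem continuousAt_curveVelocity {m : ℝ → G} (hm : ContMDiff 𝓘(ℝ, ℝ) 𝓘(ℝ, 𝔼) ∞ m) (t : ℝ) :
    ContinuousAt (curveVelocity (𝔼 := 𝔼) m) t := by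
  have h : ContMDiffOn 𝓘(ℝ, ℝ × ℝ) 𝓘(ℝ, 𝔼) ∞ (fun q : ℝ × ℝ => m q.2) (univ ×ˢ univ) :=
    (hm.comp contDiff_snd.contMDiff).contMDiffOn
  have h2 := (contDiffAt_maurerCartan_mfderiv (𝔼 := 𝔼) (Φ := fun _ : ℝ => m) isOpen_univ h 1
    (q := (0, t)) (mem_univ _)).continuousAt
  exact ContinuousAt.comp (f := fun t : ℝ => ((0 : ℝ), t)) h2 (by fun_prop)

/-- By the Leibniz rule the moving factor `m(εf)` adds its own velocity, twisted by `Ad`. The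
formula is exact in `ε`, not only to first order. -/
theorem jetLift_leftVariation {m : ℝ → G} (hm : ContMDiff 𝓘(ℝ, ℝ) 𝓘(ℝ, 𝔼) ∞ m)
    {f : Coord n → ℝ} {φ : Coord n → G} {x : Coord n} (hf : DifferentiableAt ℝ f x)
    (hφ : MDifferentiableAt 𝓘(ℝ, Coord n) 𝓘(ℝ, 𝔼) φ x) (ε : ℝ) :
    jetLift (𝔼 := 𝔼) (leftVariation m f φ ε) x = (x, m (ε * f x) * φ x, fun μ =>
      (ε * fderiv ℝ f x (partialVec μ)) • Ad (𝔼 := 𝔼) (φ x)⁻¹ (curveVelocity m (ε * f x)) +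
        (jetLift (𝔼 := 𝔼) φ x).2.2 μ) := by
  refine Prod.ext rfl (Prod.ext rfl (funext fun μ => ?_))
  have hmt : MDifferentiableAt 𝓘(ℝ, ℝ) 𝓘(ℝ, 𝔼) m (ε * f x) := hm.mdifferentiable (by simp) _
  have hg : HasFDerivAt (fun y => ε * f y) (ε • fderiv ℝ f x) x := hf.hasFDerivAt.const_mul ε
  have hγ : MDifferentiableAt 𝓘(ℝ, Coord n) 𝓘(ℝ, 𝔼) (fun y => m (ε * f y)) x :=
    hmt.comp x hg.differentiableAt.mdifferentiableAt
  have h1 := maurerCartan_mfderiv_mul (𝔼 := 𝔼) hγ hφ (partialVec μ)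
  have h2 : (mfderiv 𝓘(ℝ, Coord n) 𝓘(ℝ, 𝔼) (fun y => m (ε * f y)) x : Coord n →L[ℝ] 𝔼)
      (partialVec μ) = (ε * fderiv ℝ f x (partialVec μ)) •
        (mfderiv 𝓘(ℝ, ℝ) 𝓘(ℝ, 𝔼) m (ε * f x) : ℝ →L[ℝ] 𝔼) 1 := by
    have h3 := (HasMFDerivAt.comp x hmt.hasMFDerivAt hg.hasMFDerivAt).mfderiv
    refine (DFunLike.congr_fun h3 (partialVec μ)).trans ?_
    have key : ∀ (dm : ℝ →L[ℝ] 𝔼) (df : Coord n →L[ℝ] ℝ),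
        (dm ∘L (ε • df)) (partialVec μ) = (ε * df (partialVec μ)) • dm 1 := fun dm df => by
      rw [← map_smul, smul_eq_mul, mul_one]; rfl
    exact key _ _
  rw [h2, map_smul, map_smul] at h1
  exact h1

theorem hasMFDerivAt_jetLift_leftVariation {m : ℝ → G} (hm : ContMDiff 𝓘(ℝ, ℝ) 𝓘(ℝ, 𝔼) ∞ m)
    (hm0 : m 0 = 1) {f : Coord n → ℝ} {φ : Coord n → G} {x : Coord n}
    (hf : DifferentiableAt ℝ f x) (hφ : MDifferentiableAt 𝓘(ℝ, Coord n) 𝓘(ℝ, 𝔼) φ x) :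
    HasMFDerivAt 𝓘(ℝ, ℝ) (jetModel n 𝔼) (fun ε => jetLift (𝔼 := 𝔼) (leftVariation m f φ ε) x) 0
      ((0 : ℝ →L[ℝ] Coord n).prod ((ContinuousLinearMap.toSpanSingleton ℝ
        (f x • rightTranslate (𝔼 := 𝔼) (φ x) (curveVelocity (𝔼 := 𝔼) m 0))).prod
        (ContinuousLinearMap.toSpanSingleton ℝ fun μ =>
          fderiv ℝ f x (partialVec μ) • Ad (𝔼 := 𝔼) (φ x)⁻¹ (curveVelocity (𝔼 := 𝔼) m 0)))) := by
  rw [show (fun ε => jetLift (𝔼 := 𝔼) (leftVariation m f φ ε) x) = _ from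
    funext fun ε => jetLift_leftVariation hm hf hφ ε]
  have hg : HasFDerivAt (fun ε : ℝ => ε * f x) (ContinuousLinearMap.toSpanSingleton ℝ (f x)) 0 := by
    simpa using ((hasDerivAt_id (0 : ℝ)).mul_const (f x)).hasFDerivAt
  have hmt : MDifferentiableAt 𝓘(ℝ, ℝ) 𝓘(ℝ, 𝔼) m 0 := hm.mdifferentiable (by simp) _
  have hvel : (mfderiv 𝓘(ℝ, ℝ) 𝓘(ℝ, 𝔼) m 0 : ℝ →L[ℝ] 𝔼) 1 = curveVelocity (𝔼 := 𝔼) m 0 := by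
    unfold curveVelocity
    rw [hm0]
    exact (maurerCartan_one_apply (𝔼 := 𝔼) (G := G)
      ((mfderiv 𝓘(ℝ, ℝ) 𝓘(ℝ, 𝔼) m 0 : ℝ →L[ℝ] 𝔼) 1)).symm
  refine (hasMFDerivAt_const x 0).prodMk (HasMFDerivAt.prodMk ?_ ?_)
  · have h1 : HasMFDerivAt 𝓘(ℝ, ℝ) 𝓘(ℝ, 𝔼) m (0 * f x)
        (mfderiv 𝓘(ℝ, ℝ) 𝓘(ℝ, 𝔼) m 0 : ℝ →L[ℝ] 𝔼) := by
      rw [zero_mul]; exact hmt.hasMFDerivAt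
    rw [← hvel]
    have h2 : HasMFDerivAt 𝓘(ℝ, 𝔼) 𝓘(ℝ, 𝔼) (fun h : G => h * φ x) (m (0 * f x))
        (rightTranslate (𝔼 := 𝔼) (φ x)) := by
      rw [zero_mul, hm0]
      exact (mdifferentiable_mul_right_group (𝔼 := 𝔼) (φ x) 1).hasMFDerivAt
    refine (HasMFDerivAt.comp (0 : ℝ) h2
      (HasMFDerivAt.comp (0 : ℝ) h1 hg.hasMFDerivAt)).congr_mfderiv ?_
    have key : ∀ (dm : ℝ →L[ℝ] 𝔼) (dR : 𝔼 →L[ℝ] 𝔼),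
        dR ∘L (dm ∘L ContinuousLinearMap.toSpanSingleton ℝ (f x)) =
        ContinuousLinearMap.toSpanSingleton ℝ (f x • dR (dm 1)) := fun dm dR => by
      ext
      rw [← map_smul, ← map_smul]
      simp
    exact key _ _
  · suffices h : HasDerivAt (fun (ε : ℝ) (μ : Fin (n + 1)) =>
        (ε * fderiv ℝ f x (partialVec μ)) • Ad (𝔼 := 𝔼) (φ x)⁻¹ (curveVelocity m (ε * f x)) +
          (jetLift (𝔼 := 𝔼) φ x).2.2 μ) (fun μ => fderiv ℝ f x (partialVec μ) •
            Ad (𝔼 := 𝔼) (φ x)⁻¹ (curveVelocity m 0)) 0 from h.hasFDerivAt.hasMFDerivAt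
    refine hasDerivAt_pi.2 fun μ => ?_
    -- The added velocity has the form `ε • h ε`, whose derivative at 0 is `h 0` as soon as `h` is
    -- continuous there; no derivative of the curve velocity is needed.
    have hcont : ContinuousAt (fun ε : ℝ => fderiv ℝ f x (partialVec μ) •
        Ad (𝔼 := 𝔼) (φ x)⁻¹ (curveVelocity m (ε * f x))) 0 := by
      have : ContinuousAt (fun ε : ℝ => curveVelocity (𝔼 := 𝔼) m (ε * f x)) 0 :=
        ContinuousAt.comp (f := fun ε : ℝ => ε * f x) (continuousAt_curveVelocity hm _)
          (by fun_prop)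
      exact continuousAt_const.smul ((Ad (𝔼 := 𝔼) (φ x)⁻¹).continuous.continuousAt.comp this)
    have hlin : HasDerivAt (fun ε : ℝ => ε • (fderiv ℝ f x (partialVec μ) •
        Ad (𝔼 := 𝔼) (φ x)⁻¹ (curveVelocity m (ε * f x))))
        (fderiv ℝ f x (partialVec μ) • Ad (𝔼 := 𝔼) (φ x)⁻¹ (curveVelocity (𝔼 := 𝔼) m 0)) 0 := by
      rw [hasDerivAt_iff_tendsto_slope]
      have := hcont.tendsto
      rw [zero_mul] at this
      refine (this.mono_left nhdsWithin_le_nhds).congr' ?_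
      filter_upwards [self_mem_nhdsWithin] with ε hε
      simp [slope_def_module, smul_smul, inv_mul_cancel_left₀ (show ε ≠ 0 from hε)]
    simpa only [smul_smul] using hlin.add_const ((jetLift (𝔼 := 𝔼) φ x).2.2 μ)

/-- The first variation of the Lagrangian under localized left translations. -/
theorem hasDerivAt_leftVariation {l : Jet n 𝔼 G → ℝ} {m : ℝ → G}
    (hm : ContMDiff 𝓘(ℝ, ℝ) 𝓘(ℝ, 𝔼) ∞ m) (hm0 : m 0 = 1) {f : Coord n → ℝ} {φ : Coord n → G}
    {x : Coord n} (hf : DifferentiableAt ℝ f x)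
    (hφ : MDifferentiableAt 𝓘(ℝ, Coord n) 𝓘(ℝ, 𝔼) φ x)
    (hl : MDifferentiableAt (jetModel n 𝔼) 𝓘(ℝ, ℝ) l (jetLift φ x)) :
    HasDerivAt (fun ε => l (jetLift (leftVariation m f φ ε) x))
      (f x * jetDifferential l (jetLift φ x)
        (jetGenerator (curveVelocity (𝔼 := 𝔼) m 0) (jetLift φ x)) +
      ∑ μ, rightMomentum l μ (jetLift φ x) (curveVelocity (𝔼 := 𝔼) m 0) *
        fderiv ℝ f x (partialVec μ)) 0 := by
  have h0 : jetLift (𝔼 := 𝔼) (leftVariation m f φ 0) x = jetLift φ x := by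
    rw [leftVariation_zero hm0]
  have hl' : HasMFDerivAt (jetModel n 𝔼) 𝓘(ℝ, ℝ) l (jetLift (leftVariation m f φ 0) x)
      (jetDifferential l (jetLift φ x)) := by
    rw [h0]; exact hasMFDerivAt_jetDifferential hl
  have h2 : HasDerivAt (fun ε => l (jetLift (leftVariation m f φ ε) x))
      (jetDifferential l (jetLift φ x)
        (0, f x • rightTranslate (𝔼 := 𝔼) (φ x) (curveVelocity (𝔼 := 𝔼) m 0),
          fun μ => fderiv ℝ f x (partialVec μ) •
            Ad (𝔼 := 𝔼) (φ x)⁻¹ (curveVelocity (𝔼 := 𝔼) m 0))) 0 := by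
    rw [hasDerivAt_iff_hasFDerivAt]
    refine ((HasMFDerivAt.comp (0 : ℝ) hl'
      (hasMFDerivAt_jetLift_leftVariation hm hm0 hf hφ)).congr_mfderiv ?_).hasFDerivAt
    have key : ∀ (dl : JetTangent n 𝔼 →L[ℝ] ℝ) (a : 𝔼) (b : Fin (n + 1) → 𝔼),
        dl ∘L ((0 : ℝ →L[ℝ] Coord n).prod ((ContinuousLinearMap.toSpanSingleton ℝ a).prod
          (ContinuousLinearMap.toSpanSingleton ℝ b))) =
        ContinuousLinearMap.toSpanSingleton ℝ (dl (0, a, b)) := fun dl a b => by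
      ext
      simp
    exact key _ _ _
  convert h2 using 1
  have hw := jetDifferential_vertical hl fun μ => fderiv ℝ f x (partialVec μ) •
    Ad (𝔼 := 𝔼) (φ x)⁻¹ (curveVelocity (𝔼 := 𝔼) m 0)
  -- The variation vector is `f` times the symmetry generator plus a fibre vector; the latter pairs
  -- with the momenta.
  have hsplit : ((0, f x • rightTranslate (𝔼 := 𝔼) (φ x) (curveVelocity (𝔼 := 𝔼) m 0),
      fun μ => fderiv ℝ f x (partialVec μ) •
        Ad (𝔼 := 𝔼) (φ x)⁻¹ (curveVelocity (𝔼 := 𝔼) m 0)) : JetTangent n 𝔼) =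
      f x • jetGenerator (curveVelocity (𝔼 := 𝔼) m 0) (jetLift φ x) +
        (0, 0, fun μ => fderiv ℝ f x (partialVec μ) •
          Ad (𝔼 := 𝔼) (φ x)⁻¹ (curveVelocity (𝔼 := 𝔼) m 0)) := by
    rw [jetGenerator_eq]
    simp [jetLift]
  rw [hsplit, map_add, map_smul, hw, smul_eq_mul]
  congr 1
  refine Finset.sum_congr rfl fun μ _ => ?_
  rw [map_smul, smul_eq_mul, mul_comm]
  rfl

end Variation

/-! ### Pullback of the Noether form. -/

section Pullback

variable {n : ℕ} {𝔼 : Type*} [NormedAddCommGroup 𝔼] [NormedSpace ℝ 𝔼] [FiniteDimensional ℝ 𝔼]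
  {G : Type*} [TopologicalSpace G] [ChartedSpace 𝔼 G] [Group G]

/-- Pullback of the Noether form along a linear section of the projection to the base. -/
theorem noetherForm_comp_eq (l : Jet n 𝔼 G → ℝ) (p : Jet n 𝔼 G)
    (D : Coord n →L[ℝ] JetTangent n 𝔼) (hD : ∀ v, (D v).1 = v) :
    (noetherForm l p).compContinuousLinearMap D =
      ∑ μ, vectorForm (dnx μ) (rightMomentum l μ p) := by
  ext1 v
  rw [ContinuousAlternatingMap.compContinuousLinearMap_apply, noetherForm,
    ContinuousAlternatingMap.sum_apply, ContinuousAlternatingMap.sum_apply]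
  refine Finset.sum_congr rfl fun μ _ => ?_
  have h : baseForm n 𝔼 (dnx μ) (D ∘ v) = dnx μ v :=
    congrArg (dnx μ) (funext fun i => hD (v i))
  exact congrArg (fun c : ℝ => c • rightMomentum l μ p) h

end Pullback

/-! ### Conservation along critical sections. -/

section Conservation

variable {n : ℕ} {𝔼 : Type*} [NormedAddCommGroup 𝔼] [NormedSpace ℝ 𝔼]
  {G : Type*} [TopologicalSpace G] [ChartedSpace 𝔼 G] [Group G] [LieGroup 𝓘(ℝ, 𝔼) ∞ G]
  {l : Jet n 𝔼 G → ℝ} {φ : Coord n → G} {U : Set (Coord n)}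

/-- Stationarity of the action under localized left translations. -/
theorem integral_rightMomentum_mul_fderiv_eq_zero (hU : IsOpen U)
    (hl : ContMDiffOn (jetModel n 𝔼) 𝓘(ℝ, ℝ) ∞ l {p | p.1 ∈ U})
    (hφ : ContMDiffOn 𝓘(ℝ, Coord n) 𝓘(ℝ, 𝔼) ∞ φ U) (hcrit : IsCriticalOn l U φ) {η : 𝔼}
    (hsym : ∀ p : Jet n 𝔼 G, p.1 ∈ U → jetDifferential l p (jetGenerator η p) = 0)
    {f : Coord n → ℝ} (hf : ContDiff ℝ ∞ f) (hfc : HasCompactSupport f) (hfU : tsupport f ⊆ U) :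
    ∫ x, ∑ μ, rightMomentum l μ (jetLift φ x) η * fderiv ℝ f x (partialVec μ) = 0 := by
  obtain ⟨m, hm, hm0, hmη⟩ := exists_curve_one (G := G) η
  have hvel : curveVelocity (𝔼 := 𝔼) m 0 = η := by
    unfold curveVelocity
    rw [hm0, ← hmη]
    exact maurerCartan_one_apply (𝔼 := 𝔼) (G := G)
      ((mfderiv 𝓘(ℝ, ℝ) 𝓘(ℝ, 𝔼) m 0 : ℝ →L[ℝ] 𝔼) 1)
  have hΦ := contMDiffOn_leftVariation hm hf hφ
  have hlat : ∀ p : Jet n 𝔼 G, p.1 ∈ U → ContMDiffAt (jetModel n 𝔼) 𝓘(ℝ, ℝ) ∞ l p := fun p hp =>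
    hl.contMDiffAt ((hU.preimage continuous_fst).mem_nhds hp)
  have hF : ContDiffOn ℝ 1 (fun q : ℝ × Coord n =>
      l (jetLift (leftVariation m f φ q.1) q.2)) (univ ×ˢ U) := fun q hq =>
    ((ContMDiffAt.comp q (hlat (jetLift (leftVariation m f φ q.1) q.2) hq.2)
      (contMDiffAt_jetLift hU hΦ hq.2)).contDiffAt.of_le (by simp)).contDiffWithinAt
  have h1 := hasDerivAt_setIntegral_of_contDiffOn (ν := volume)
    (f := fun ε x => l (jetLift (leftVariation m f φ ε) x)) hU hfc hfU hF 0
  -- The compact set is the support of `f`: off it, `m(εf) = m(0) = 1` and the variation is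
  -- constant.
  have h2 := hcrit (tsupport f) (leftVariation m f φ) hfc hfU
    -- The vector-space and product manifold structures on `ℝ × Coord n` must be identified.
    (by rw [modelWithCornersSelf_prod, ← chartedSpaceSelf_prod] at hΦ; exact hΦ)
    (fun x _ => by rw [leftVariation_zero hm0])
    (fun ε x _ hx => by simp [leftVariation, image_eq_zero_of_notMem_tsupport hx, hm0])
  have h3 := h1.unique h2
  rw [← h3, ← setIntegral_eq_integral_of_forall_compl_eq_zero (s := tsupport f)]
  · refine setIntegral_congr_fun hfc.measurableSet fun x hx => ?_
    have hxU := hfU hx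
    have h4 := (hasDerivAt_leftVariation hm hm0 (hf.differentiable (by simp) x)
      ((hφ.contMDiffAt (hU.mem_nhds hxU)).mdifferentiableAt (by simp))
      ((hlat (jetLift φ x) hxU).mdifferentiableAt (by simp))).deriv
    rw [hvel, hsym (jetLift φ x) hxU, mul_zero, zero_add] at h4
    exact h4.symm
  · intro x hx
    have : fderiv ℝ f x = 0 :=
      image_eq_zero_of_notMem_tsupport fun h => hx (tsupport_fderiv_subset ℝ h)
    simp [this]

/-- The balance law for the right momentum along a critical section. -/
theorem sum_fderiv_rightMomentum_eq_zero (hU : IsOpen U)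
    (hl : ContMDiffOn (jetModel n 𝔼) 𝓘(ℝ, ℝ) ∞ l {p | p.1 ∈ U})
    (hφ : ContMDiffOn 𝓘(ℝ, Coord n) 𝓘(ℝ, 𝔼) ∞ φ U) (hcrit : IsCriticalOn l U φ)
    (hsym : ∀ (η : 𝔼) (p : Jet n 𝔼 G), p.1 ∈ U → jetDifferential l p (jetGenerator η p) = 0)
    {x : Coord n} (hx : x ∈ U) :
    ∑ μ, fderiv ℝ (fun y => rightMomentum l μ (jetLift φ y)) x (partialVec μ) = 0 := by
  have hsmooth := fun μ => contDiffOn_rightMomentum_jetLift hU hl hφ μ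
  ext η
  have h1 := sum_fderiv_eq_zero_of_integral_eq_zero hU
    (w := fun μ y => rightMomentum l μ (jetLift φ y) η)
    (fun μ => ((hsmooth μ).of_le (by simp)).clm_apply contDiffOn_const)
    (fun f hf hfc hfU => integral_rightMomentum_mul_fderiv_eq_zero hU hl hφ hcrit (hsym η)
      hf hfc hfU) x hx
  rw [_root_.sum_apply, _root_.zero_apply, ← h1]
  refine Finset.sum_congr rfl fun μ _ => ?_
  have hd : DifferentiableAt ℝ (fun y => rightMomentum l μ (jetLift φ y)) x :=
    ((hsmooth μ).differentiableOn (by simp)).differentiableAt (hU.mem_nhds hx)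
  rw [fderiv_clm_apply hd (differentiableAt_const η)]
  simp

/-- The jet lift is a section over the base, so its differential followed by the base projection is
the identity and the forms `dⁿx_μ` pull back to themselves. -/
theorem pullbackNoether_eq [FiniteDimensional ℝ 𝔼] (hU : IsOpen U)
    (hφ : ContMDiffOn 𝓘(ℝ, Coord n) 𝓘(ℝ, 𝔼) ∞ φ U) {x : Coord n} (hx : x ∈ U) :
    pullbackNoether l φ x = ∑ μ, vectorForm (dnx μ) (rightMomentum l μ (jetLift φ x)) := by
  have hj : MDifferentiableAt 𝓘(ℝ, Coord n) (jetModel n 𝔼) (jetLift (𝔼 := 𝔼) φ) x :=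
    (contMDiffAt_jetLift_section hU hφ hx).mdifferentiableAt (by simp)
  have h1 := mfderiv_comp x (mdifferentiableAt_fst (I := 𝓘(ℝ, Coord n))
    (I' := 𝓘(ℝ, 𝔼).prod 𝓘(ℝ, Fin (n + 1) → 𝔼)) (x := jetLift (𝔼 := 𝔼) φ x)) hj
  have h2 : Prod.fst ∘ jetLift (𝔼 := 𝔼) φ = id := rfl
  rw [h2, mfderiv_id, mfderiv_fst] at h1
  have h3 : ∀ v : Coord n, ((mfderiv 𝓘(ℝ, Coord n) (jetModel n 𝔼) (jetLift (𝔼 := 𝔼) φ) x :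
      Coord n →L[ℝ] JetTangent n 𝔼) v).1 = v := fun v => (DFunLike.congr_fun h1 v).symm
  exact noetherForm_comp_eq l _ _ h3

end Conservation

/-! ### Local representatives of sections and the main theorem. -/

section Representative

variable {n : ℕ} {𝔼 : Type*} [NormedAddCommGroup 𝔼] [NormedSpace ℝ 𝔼]
  {G : Type*} [TopologicalSpace G] [ChartedSpace 𝔼 G] [Group G]
  {M : Type*} [TopologicalSpace M] [ChartedSpace (Coord n) M]
  {F : Type*} [NormedAddCommGroup F] [NormedSpace ℝ F]
  {P : Type*} [TopologicalSpace P] [ChartedSpace F P] [MulAction G P]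
  {pr : P → M} {vol : (x : M) → TangentSpace 𝓘(ℝ, Coord n) x [⋀^Fin (n + 1)]→L[ℝ] ℝ}

theorem NaturalSystem.contMDiffOn_rep (S : NaturalSystem 𝔼 F G pr vol) {O : Set M} {σ : M → P}
    (hO : IsOpen O) (hσ : IsSmoothSection n F pr O σ) (hSO : S.chart.source ⊆ O) :
    ContMDiffOn 𝓘(ℝ, Coord n) 𝓘(ℝ, 𝔼) ∞ (S.rep σ) S.domain := by
  intro x hx
  have hy := S.chart.map_target hx
  have hmem : σ (S.chart.symm x) ∈ S.triv.source := by
    rw [S.triv.mem_source, hσ.proj _ (hSO hy)]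
    exact S.source_subset hy
  have h1 : ContMDiffAt 𝓘(ℝ, Coord n) 𝓘(ℝ, Coord n) ∞ S.chart.symm x :=
    (contMDiffOn_symm_of_mem_maximalAtlas S.adapted.mem_atlas).contMDiffAt
      (S.isOpen_domain.mem_nhds hx)
  have h2 := hσ.smooth.contMDiffAt (hO.mem_nhds (hSO hy))
  have h3 := S.principal.smooth.contMDiffAt (S.triv.open_source.mem_nhds hmem)
  exact ((h3.comp x (h2.comp x h1)).snd).contMDiffWithinAt

end Representative

end ReducedNoether

theorem mainTheorem3 {n : ℕ}
    {𝔼 : Type*} [NormedAddCommGroup 𝔼] [NormedSpace ℝ 𝔼] [FiniteDimensional ℝ 𝔼]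
    {G : Type*} [TopologicalSpace G] [ChartedSpace 𝔼 G] [Group G] [LieGroup 𝓘(ℝ, 𝔼) ∞ G]
    {M : Type*} [TopologicalSpace M] [ChartedSpace (ReducedNoether.Coord n) M]
    [IsManifold 𝓘(ℝ, ReducedNoether.Coord n) ∞ M]
    {F : Type*} [NormedAddCommGroup F] [NormedSpace ℝ F] [FiniteDimensional ℝ F]
    {P : Type*} [TopologicalSpace P] [ChartedSpace F P] [IsManifold 𝓘(ℝ, F) ∞ P] [MulAction G P]
    (pr : P → M) (hpr : ReducedNoether.IsPrincipalBundle n 𝔼 F G pr)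
    (vol : (x : M) → TangentSpace 𝓘(ℝ, ReducedNoether.Coord n) x [⋀^Fin (n + 1)]→L[ℝ] ℝ)
    (hvol : ReducedNoether.IsVolumeForm vol)
    (L : ReducedNoether.Lagrangian n F pr) (hL : ReducedNoether.IsSmoothLagrangian 𝔼 G vol L)
    (S : ReducedNoether.NaturalSystem 𝔼 F G pr vol) :
    -- the current `j¹S_η ⌟ Θ_ℓ` is `⟨Π^μ, η⟩ dⁿx_μ = ⟨J, η⟩`
    (∀ (η : 𝔼), ∀ p ∈ S.jets,
      (ReducedNoether.poincareCartan (S.reduced L) p).curryLeft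
          (ReducedNoether.jetGenerator η p) =
        ∑ μ, ReducedNoether.rightMomentum (S.reduced L) μ p η •
          ReducedNoether.baseForm n 𝔼 (ReducedNoether.dnx μ) ∧
      ∀ v : Fin n → ReducedNoether.JetTangent n 𝔼,
        (ReducedNoether.poincareCartan (S.reduced L) p).curryLeft
          (ReducedNoether.jetGenerator η p) v =
        ReducedNoether.noetherForm (S.reduced L) p v η) ∧
    -- invariance under left multiplication makes every `S_η` an infinitesimal symmetry
    (ReducedNoether.IsLeftInvariant G L → ∀ η : 𝔼, S.IsInfinitesimalSymmetry L η) ∧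
    -- if all `S_η` are symmetries, then `J` is closed on critical sections: balance law
    ((∀ η : 𝔼, S.IsInfinitesimalSymmetry L η) →
      ∀ (O : Set M) (σ : M → P), IsOpen O → ReducedNoether.IsSmoothSection n F pr O σ →
        ReducedNoether.IsCriticalSection 𝔼 G vol L O σ → S.chart.source ⊆ O →
        (∀ μ, ContDiffOn ℝ ∞ (fun x => ReducedNoether.rightMomentum (S.reduced L) μ
          (ReducedNoether.jetLift (S.rep σ) x)) S.domain) ∧
        ContDiffOn ℝ ∞ (ReducedNoether.pullbackNoether (S.reduced L) (S.rep σ)) S.domain ∧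
        ∀ x ∈ S.domain,
          extDeriv (ReducedNoether.pullbackNoether (S.reduced L) (S.rep σ)) x = 0 ∧
          extDeriv (ReducedNoether.pullbackNoether (S.reduced L) (S.rep σ)) x =
            (ContinuousLinearMap.toSpanSingleton ℝ
              (∑ μ, fderiv ℝ (fun y => ReducedNoether.rightMomentum (S.reduced L) μ
                (ReducedNoether.jetLift (S.rep σ) y)) x (ReducedNoether.partialVec μ)
                )).compContinuousAlternatingMap (ReducedNoether.stdVolume n) ∧
          ∑ μ, fderiv ℝ (fun y => ReducedNoether.rightMomentum (S.reduced L) μ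
            (ReducedNoether.jetLift (S.rep σ) y)) x (ReducedNoether.partialVec μ) = 0) := by
  have hU := S.isOpen_domain
  refine ⟨fun η p _ => ⟨ReducedNoether.curryLeft_poincareCartan_jetGenerator _ p η, fun v => ?_⟩,
    fun hinv η => S.isInfinitesimalSymmetry_of_isLeftInvariant hpr hL hinv η, ?_⟩
  · rw [ReducedNoether.noetherForm_apply_apply,
      ReducedNoether.curryLeft_poincareCartan_jetGenerator]
  · intro hsym O σ hO hσ hcrit hSO
    have hφ := S.contMDiffOn_rep hO hσ hSO
    have hsmooth := fun μ => ReducedNoether.contDiffOn_rightMomentum_jetLift hU (hL S) hφ μ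
    have hpull : ∀ x ∈ S.domain, ReducedNoether.pullbackNoether (S.reduced L) (S.rep σ) x =
        ∑ μ, ReducedNoether.vectorForm (ReducedNoether.dnx μ)
          (ReducedNoether.rightMomentum (S.reduced L) μ
            (ReducedNoether.jetLift (S.rep σ) x)) := fun x hx =>
      ReducedNoether.pullbackNoether_eq hU hφ hx
    have hbal : ∀ x ∈ S.domain, ∑ μ, fderiv ℝ (fun y => ReducedNoether.rightMomentum
        (S.reduced L) μ (ReducedNoether.jetLift (S.rep σ) y)) x
          (ReducedNoether.partialVec μ) = 0 := fun x hx =>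
      ReducedNoether.sum_fderiv_rightMomentum_eq_zero hU (hL S) hφ (hcrit S hSO)
        (fun η p hp => hsym η p hp) hx
    have hext : ∀ x ∈ S.domain,
        extDeriv (ReducedNoether.pullbackNoether (S.reduced L) (S.rep σ)) x =
          ReducedNoether.vectorForm (ReducedNoether.stdVolume n)
            (∑ μ, fderiv ℝ (fun y => ReducedNoether.rightMomentum (S.reduced L) μ
              (ReducedNoether.jetLift (S.rep σ) y)) x (ReducedNoether.partialVec μ)) := by
      intro x hx
      rw [← ReducedNoether.extDeriv_sum_vectorForm_dnx fun μ =>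
        ((hsmooth μ).differentiableOn (by simp)).differentiableAt (hU.mem_nhds hx)]
      -- The coordinate expression of the pullback is known only on the domain; the exterior
      -- derivative depends only on the germ.
      refine Filter.EventuallyEq.extDeriv_eq ?_
      filter_upwards [hU.mem_nhds hx] with y hy
      exact hpull y hy
    refine ⟨hsmooth, ?_, fun x hx => ⟨?_, hext x hx, hbal x hx⟩⟩
    · refine ContDiffOn.congr ?_ hpull
      exact ContDiffOn.sum fun μ _ =>
        (ReducedNoether.vectorForm (V := 𝔼 →L[ℝ] ℝ)
          (ReducedNoether.dnx μ)).contDiff.comp_contDiffOn (hsmooth μ)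
    · rw [hext x hx, hbal x hx, map_zero]
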